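/- Let $\mathcal H=L^2(\mathbb R^2)$ and let $U_t=e^{-itH}$, $t\in\mathbb R$, be the unitary group of the two-mode Hamiltonian $H=\frac{p_1^2}{2}+\frac{p_2^2}{2}+\frac{(q_2-q_1)^2}{2}$ (with $q_j$ multiplication by the $j$th coordinate and $p_j=-i\partial_j$), that is, the unique strongly continuous one-parameter unitary group with $\frac{d}{dt}U_tf|_{t=0}=-iHf$ for every Schwartz function $f$. For $\alpha,\beta\in\mathbb C$ put $$\xi_\alpha(u)=\pi^{-1/4}e^{-|\alpha|^2/2}e^{-(u^2-2\sqrt2\,\alpha u+\alpha^2)/2},\qquad \psi_{\alpha\beta}(x,y)=2^{1/4}\,\xi_\alpha\!\left(\tfrac{x+y}{\sqrt[4]{2}}\right)\xi_\beta\!\left(\tfrac{x-y}{\sqrt[4]{2}}\right),$$ and let $Q_\beta=\frac1\pi\int_{\mathbb C}|\psi_{\alpha\beta}\rangle\langle\psi_{\alpha\beta}|\,d^2\alpha$ (a weak integral). Below, $\overline{\mathrm{span}}$ is the closed linear span in the weak operator topology (equivalently, in the strong operator topology). Then the group $U_t$ exists and is unique, the weak integral defining $Q_\beta$ exists and is an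 orthogonal projection for every $\beta\in\mathbb C$, and $$U_tQ_\beta U_t^*=Q_{e^{-i\sqrt2 t}\beta}\qquad(t\in\mathbb R,\ \beta\in\mathbb C).$$ For every $\varphi\in\mathbb R$ the operator space $$\mathcal V=\overline{\mathrm{span}}\{U_tQ_{re^{i\varphi}}U_t^*:\ t\in\mathbb R,\ r\ge 0\}=\overline{\mathrm{span}}\{Q_{re^{i(\varphi-\sqrt2 t)}}:\ t\in\mathbb R,\ r\ge0\}$$ is a non-commutative graph: a linear space of bounded operators that contains the adjoint of each of its elements and contains the identity. The space $\mathcal V$ does not depend on $\varphi$. -/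

import Mathlib

open MeasureTheory SchwartzMap
open scoped InnerProductSpace LineDeriv ComplexConjugate

noncomputable section

/-- The Hilbert space `L²(ℝ²)` of the two-mode oscillator. -/
abbrev TwoModeSpace : Type := Lp ℂ 2 (volume : Measure (ℝ × ℝ))

/-! ### The Hamiltonian on Schwartz functions -/

/-- The position operator `q₁`: multiplication by the first coordinate. -/
def positionOne : 𝓢(ℝ × ℝ, ℂ) →L[ℂ] 𝓢(ℝ × ℝ, ℂ) :=
  SchwartzMap.smulLeftCLM ℂ (fun z : ℝ × ℝ => (z.1 : ℂ))

/-- The position operator `q₂`: multiplication by the second coordinate. -/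
def positionTwo : 𝓢(ℝ × ℝ, ℂ) →L[ℂ] 𝓢(ℝ × ℝ, ℂ) :=
  SchwartzMap.smulLeftCLM ℂ (fun z : ℝ × ℝ => (z.2 : ℂ))

theorem positionOne_apply (f : 𝓢(ℝ × ℝ, ℂ)) (z : ℝ × ℝ) :
    positionOne f z = (z.1 : ℂ) * f z :=
  SchwartzMap.smulLeftCLM_apply_apply (g := fun z : ℝ × ℝ => (z.1 : ℂ))
    ((Complex.ofRealCLM.comp (ContinuousLinearMap.fst ℝ ℝ ℝ)).hasTemperateGrowth) f z

theorem positionTwo_apply (f : 𝓢(ℝ × ℝ, ℂ)) (z : ℝ × ℝ) :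
    positionTwo f z = (z.2 : ℂ) * f z :=
  SchwartzMap.smulLeftCLM_apply_apply (g := fun z : ℝ × ℝ => (z.2 : ℂ))
    ((Complex.ofRealCLM.comp (ContinuousLinearMap.snd ℝ ℝ ℝ)).hasTemperateGrowth) f z

/-- The momentum operator `p₁ = -i ∂/∂x`. -/
def momentumOne (f : 𝓢(ℝ × ℝ, ℂ)) : 𝓢(ℝ × ℝ, ℂ) :=
  (-Complex.I) • ∂_{((1, 0) : ℝ × ℝ)} f

/-- The momentum operator `p₂ = -i ∂/∂y`. -/
def momentumTwo (f : 𝓢(ℝ × ℝ, ℂ)) : 𝓢(ℝ × ℝ, ℂ) :=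
  (-Complex.I) • ∂_{((0, 1) : ℝ × ℝ)} f

/-- The Hamiltonian `H = p₁²/2 + p₂²/2 + (q₂ - q₁)²/2` on Schwartz functions
(on which it is essentially self-adjoint). -/
def hamiltonian (f : 𝓢(ℝ × ℝ, ℂ)) : 𝓢(ℝ × ℝ, ℂ) :=
  (1 / 2 : ℂ) • momentumOne (momentumOne f) + (1 / 2 : ℂ) • momentumTwo (momentumTwo f)
    + (1 / 2 : ℂ) • (positionTwo - positionOne) ((positionTwo - positionOne) f)

/-! ### The unitary group `U_t = e^{-itH}` -/

/-- `U` is the strongly continuous one-parameter unitary group `U_t = e^{-itH}`: its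
infinitesimal generator extends `-iH` on Schwartz functions. -/
structure IsSchrodingerGroup (U : ℝ → (TwoModeSpace →L[ℂ] TwoModeSpace)) : Prop where
  unitary : ∀ t, U t ∈ unitary (TwoModeSpace →L[ℂ] TwoModeSpace)
  map_zero : U 0 = 1
  map_add : ∀ s t, U (s + t) = U s * U t
  strongly_continuous : ∀ ψ : TwoModeSpace, Continuous fun t => U t ψ
  generator : ∀ f : 𝓢(ℝ × ℝ, ℂ),
    HasDerivAt (fun t => U t (f.toLp 2 volume))
      ((-Complex.I) • (hamiltonian f).toLp 2 volume) 0

/-- The unitary group `U_t = e^{-itH}`: the one and only `U` with `IsSchrodingerGroup U`. -/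
def evolution : ℝ → (TwoModeSpace →L[ℂ] TwoModeSpace) :=
  Classical.epsilon IsSchrodingerGroup

/-! ### Coherent states -/

/-- The coherent state `ξ_α(u) = π^{-1/4} exp(-|α|²/2) exp(-(u² - 2√2 α u + α²)/2)`. -/
def coherent (α : ℂ) (u : ℝ) : ℂ :=
  ((Real.pi ^ (-(1 / 4) : ℝ) : ℝ) : ℂ) * Complex.exp (-((‖α‖ : ℂ) ^ 2) / 2)
    * Complex.exp (-((u : ℂ) ^ 2 - 2 * (Real.sqrt 2 : ℂ) * α * u + α ^ 2) / 2)

/-- The function `ψ_{αβ}(x, y) = 2^{1/4} ξ_α((x + y)/2^{1/4}) ξ_β((x - y)/2^{1/4})`; the factor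
`2^{1/4}` makes it a unit vector of `L²(ℝ²)`. -/
def twoModeFun (α β : ℂ) (z : ℝ × ℝ) : ℂ :=
  (((2 : ℝ) ^ (1 / 4 : ℝ) : ℝ) : ℂ)
    * coherent α ((z.1 + z.2) / (2 : ℝ) ^ (1 / 4 : ℝ))
    * coherent β ((z.1 - z.2) / (2 : ℝ) ^ (1 / 4 : ℝ))

theorem continuous_twoModeFun (α β : ℂ) : Continuous (twoModeFun α β) := by
  unfold twoModeFun coherent
  fun_prop

theorem norm_coherent (α : ℂ) (u : ℝ) :
    ‖coherent α u‖ = Real.pi ^ (-(1 / 4) : ℝ) *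
      Real.exp (-(‖α‖ ^ 2) / 2 - (u ^ 2 - 2 * Real.sqrt 2 * α.re * u + (α ^ 2).re) / 2) := by
  have hp : (0 : ℝ) < Real.pi ^ (-(1 / 4) : ℝ) := by positivity
  have e1 : (-((‖α‖ : ℂ) ^ 2) / 2).re = -(‖α‖ ^ 2) / 2 := by
    rw [show (-((‖α‖ : ℂ) ^ 2) / 2) = ((-(‖α‖ ^ 2) / 2 : ℝ) : ℂ) by push_cast; rfl,
      Complex.ofReal_re]
  have e2 : (-((u : ℂ) ^ 2 - 2 * (Real.sqrt 2 : ℂ) * α * u + α ^ 2) / 2).re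
      = -(u ^ 2 - 2 * Real.sqrt 2 * α.re * u + (α ^ 2).re) / 2 := by
    simp [pow_two]
  rw [coherent, norm_mul, norm_mul, Complex.norm_exp, Complex.norm_exp, Complex.norm_real,
    Real.norm_of_nonneg hp.le, e1, e2, mul_assoc, ← Real.exp_add]
  congr 2
  ring

theorem memLp_twoModeFun (α β : ℂ) :
    MemLp (twoModeFun α β) 2 (volume : Measure (ℝ × ℝ)) := by
  rw [memLp_two_iff_integrable_sq_norm (continuous_twoModeFun α β).aestronglyMeasurable]
  have hc : (0 : ℝ) < (2 : ℝ) ^ (1 / 4 : ℝ) := by positivity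
  set c : ℝ := (2 : ℝ) ^ (1 / 4 : ℝ) with hcdef
  have hq : ∀ d : ℝ, Integrable fun x : ℝ => Real.exp (-(2 / c ^ 2) * x ^ 2 + d * x) := by
    intro d
    have hre : 0 < (((2 / c ^ 2 : ℝ)) : ℂ).re := by
      rw [Complex.ofReal_re]
      positivity
    refine (integrable_cexp_quadratic hre (d : ℂ) 0).norm.congr
      (Filter.Eventually.of_forall fun x => ?_)
    simp only [Complex.norm_exp]
    rw [show (-((2 / c ^ 2 : ℝ) : ℂ) * (x : ℂ) ^ 2 + (d : ℂ) * x + 0)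
      = ((-(2 / c ^ 2) * x ^ 2 + d * x : ℝ) : ℂ) by push_cast; ring, Complex.ofReal_re]
  have h := ((hq (2 * Real.sqrt 2 * (α.re + β.re) / c)).mul_prod
    (hq (2 * Real.sqrt 2 * (α.re - β.re) / c))).const_mul
    ((c * (Real.pi ^ (-(1 / 4) : ℝ)) ^ 2) ^ 2
      * Real.exp (-(‖α‖ ^ 2) - ‖β‖ ^ 2 - (α ^ 2).re - (β ^ 2).re))
  refine h.congr (Filter.Eventually.of_forall fun z => ?_)
  simp only [twoModeFun, norm_mul, norm_coherent, Complex.norm_real, ← hcdef,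
    Real.norm_of_nonneg hc.le]
  rw [← Real.exp_add, mul_assoc, ← Real.exp_add]
  simp only [mul_pow, ← Real.exp_nat_mul]
  rw [show ∀ a b p q : ℝ, a * (p * Real.exp b) * (p * Real.exp q)
    = a * p ^ 2 * Real.exp (b + q) by intro a b p q; rw [Real.exp_add]; ring]
  congr 2
  push_cast
  field_simp
  ring

/-- The unit vector `ψ_{αβ}` of `L²(ℝ²)`. -/
def twoModeState (α β : ℂ) : TwoModeSpace :=
  (memLp_twoModeFun α β).toLp (twoModeFun α β)

/-! ### The operators `Q_β` -/

/-- `Q = (1/π) ∫_ℂ |ψ_{αβ}⟩⟨ψ_{αβ}| d²α`, the integral being understood weakly, with respect to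
Lebesgue measure on `ℂ`. This determines `Q`. -/
def IsCoherentIntegral (β : ℂ) (Q : TwoModeSpace →L[ℂ] TwoModeSpace) : Prop :=
  ∀ f g : TwoModeSpace,
    Integrable (fun α : ℂ => ⟪f, twoModeState α β⟫_ℂ * ⟪twoModeState α β, g⟫_ℂ) ∧
    ⟪f, Q g⟫_ℂ
      = (1 / Real.pi : ℂ) * ∫ α : ℂ, ⟪f, twoModeState α β⟫_ℂ * ⟪twoModeState α β, g⟫_ℂ

/-- The operator `Q_β = (1/π) ∫_ℂ |ψ_{αβ}⟩⟨ψ_{αβ}| d²α`. -/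
def projQ (β : ℂ) : TwoModeSpace →L[ℂ] TwoModeSpace :=
  Classical.epsilon (IsCoherentIntegral β)

/-! ### Non-commutative graphs -/

/-- The closed linear span of a set of bounded operators, the closure being taken in the weak
operator topology (for linear subspaces this is also the closure in the strong operator
topology). -/
def closedOperatorSpan (S : Set (TwoModeSpace →L[ℂ] TwoModeSpace)) :
    Submodule ℂ (TwoModeSpace →L[ℂ] TwoModeSpace) :=
  (((Submodule.span ℂ S).comap
      (ContinuousLinearMapWOT.linearEquiv (σ := RingHom.id ℂ)
        (E := TwoModeSpace) (F := TwoModeSpace) ℂ).toLinearMap).topologicalClosure).comap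
    (ContinuousLinearMapWOT.linearEquiv (σ := RingHom.id ℂ)
      (E := TwoModeSpace) (F := TwoModeSpace) ℂ).symm.toLinearMap

/-- A non-commutative graph: a linear space of bounded operators that is closed under taking
adjoints and contains the identity. -/
def IsNoncommutativeGraph (V : Submodule ℂ (TwoModeSpace →L[ℂ] TwoModeSpace)) : Prop :=
  (∀ A ∈ V, star A ∈ V) ∧ 1 ∈ V

/-- The operator space `𝒱`: the closed span of `U_t Q_{r e^{iφ}} U_t^*`, `t ∈ ℝ`, `r ≥ 0`. -/
def orbitGraph (φ : ℝ) : Submodule ℂ (TwoModeSpace →L[ℂ] TwoModeSpace) :=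
  closedOperatorSpan {A | ∃ t r : ℝ, 0 ≤ r ∧
    A = evolution t * projQ (r * Complex.exp (Complex.I * φ)) * star (evolution t)}

end

/-!
In the coordinates `s = (x + y) / 2^{1/4}` and `w = (x - y) / 2^{1/4}` the Hamiltonian is `√2` times
a free particle in `s` plus a harmonic oscillator in `w`, and `ψ_{αβ}` is a coherent state `ξ_α` in
`s` times a coherent state `ξ_β` in `w`.

The group `e^{-itH}` is built from explicit solutions. Products of a Gaussian in `s` of complex
variance `σ` with a coherent state in `w` remain of this form under the Schrödinger equation: `σ`
moves to `σ + i√2 t`, the centre stays, and the amplitude of the coherent state turns by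
`e^{-i√2 t}` (`GaussianParam.isSolution`). These functions are total in `L²`
(`dense_span_gaussianParam`). As `H` is symmetric on Schwartz functions, the solutions keep their
inner products, so they define unitary operators; pairing with the solutions shows that the
generator of this group is `-iH` on every Schwartz function (`exists_hasGenerator`). Conversely the
solutions stay in the Schwartz space, so every group with this generator must follow them
(`HasGenerator.apply_solution`), which gives uniqueness.

The overlaps of the `ψ_{αβ}` with fixed `β` form a reproducing kernel for `(1/π) d²α`, by a Gaussian
integral. For any family of vectors with this property the weak integral of the rank one operators
exists and is the orthogonal projection onto the closed span (`IsReproducing.resolution`). Hence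
`Q_β` is the projection onto `coherentSpace β`. That space contains all Gaussians in `s` times `ξ_β`
(`gaussian_mem_coherentSpace`), so the evolution maps it onto `coherentSpace (e^{-i√2 t} β)`, and
`U_t Q_β U_t^* = Q_{e^{-i√2 t} β}` follows.

Consequently both generating sets of the operator space consist of all `Q_β`, `β ∈ ℂ`, whatever
the angle. They are self-adjoint, and the adjoint is continuous in the weak operator topology. The
family of all `ψ_{αβ}` is reproducing and total, so `(1/π) ∫ Q_β d²β = 1` weakly, which puts the
identity in the closed span (`one_mem_closedOperatorSpan_range_projQ`).
-/

noncomputable section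

/-! ### Unitary groups from explicit solutions -/

section AbstractGroup

variable {H E I : Type*} [NormedAddCommGroup H] [InnerProductSpace ℂ H]
  [AddCommGroup E] [Module ℂ E]

/-- `γ` solves `γ' = A γ`, the derivative being taken in `H` after the map `ι`. In the application `E`
is the Schwartz space and `ι` its inclusion in `L²`. -/
def IsSolution (ι : E →ₗ[ℂ] H) (A : E → E) (γ : ℝ → E) : Prop :=
  ∀ t, HasDerivAt (fun s => ι (γ s)) (ι (A (γ t))) t

/-- The evolution equation of a skew-symmetric operator preserves inner products of solutions. -/
theorem IsSolution.inner_eq {ι : E →ₗ[ℂ] H} {A : E → E}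
    (hA : ∀ f g, ⟪ι (A f), ι g⟫_ℂ = -⟪ι f, ι (A g)⟫_ℂ)
    {γ δ : ℝ → E} (hγ : IsSolution ι A γ) (hδ : IsSolution ι A δ) (t : ℝ) :
    ⟪ι (γ t), ι (δ t)⟫_ℂ = ⟪ι (γ 0), ι (δ 0)⟫_ℂ := by
  have hd : ∀ t, HasDerivAt (fun s => ⟪ι (γ s), ι (δ s)⟫_ℂ) 0 t := fun t => by
    have := (hγ t).inner ℂ (hδ t)
    rwa [hA, add_neg_cancel] at this
  exact is_const_of_deriv_eq_zero (fun t => (hd t).differentiableAt) (fun t => (hd t).deriv) t 0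

theorem IsSolution.eq_of_initial_eq {ι : E →ₗ[ℂ] H} {A : E → E}
    (hA : ∀ f g, ⟪ι (A f), ι g⟫_ℂ = -⟪ι f, ι (A g)⟫_ℂ)
    {γ δ : ℝ → E} (hγ : IsSolution ι A γ) (hδ : IsSolution ι A δ) (h0 : ι (γ 0) = ι (δ 0))
    (t : ℝ) : ι (γ t) = ι (δ t) := by
  rw [← sub_eq_zero, ← inner_self_eq_zero (𝕜 := ℂ)]
  simp only [inner_sub_left, inner_sub_right, hγ.inner_eq hA hγ t, hγ.inner_eq hA hδ t,
    hδ.inner_eq hA hγ t, hδ.inner_eq hA hδ t, h0, sub_self]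

variable [CompleteSpace H]

/-- `U` is a strongly continuous one-parameter unitary group on `H` whose generator extends the
operator `A`, which is defined on the space `E` only. -/
structure HasGenerator (ι : E →ₗ[ℂ] H) (A : E → E) (U : ℝ → (H →L[ℂ] H)) : Prop where
  unitary : ∀ t, U t ∈ unitary (H →L[ℂ] H)
  map_zero : U 0 = 1
  map_add : ∀ s t, U (s + t) = U s * U t
  strongly_continuous : ∀ x : H, Continuous fun t => U t x
  generator : ∀ f : E, HasDerivAt (fun t => U t (ι f)) (ι (A f)) 0

theorem norm_apply_of_mem_unitary {U : H →L[ℂ] H} (hU : U ∈ unitary (H →L[ℂ] H)) (x : H) :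
    ‖U x‖ = ‖x‖ :=
  (ContinuousLinearMap.norm_map_iff_adjoint_comp_self U).2 (Unitary.star_mul_self_of_mem hU) x

/-- A group whose generator extends `A` moves the initial value of each solution along that solution.
Only the values of the generator on `E` are used: `s ↦ U (-s) (ι (γ s))` has derivative zero at `t`
because `ι (γ s)` and `U (s - t) (ι (γ t))` agree to first order there. -/
theorem HasGenerator.apply_solution {ι : E →ₗ[ℂ] H} {A : E → E} {U : ℝ → (H →L[ℂ] H)}
    (hU : HasGenerator ι A U) {γ : ℝ → E} (hγ : IsSolution ι A γ) (t : ℝ) :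
    U t (ι (γ 0)) = ι (γ t) := by
  have hneg : ∀ t x, U t (U (-t) x) = x := fun t x => by
    rw [← mul_apply_eq_comp, ← hU.map_add, add_neg_cancel, hU.map_zero]; rfl
  have hd : ∀ t, HasDerivAt (fun s => U (-s) (ι (γ s))) 0 t := by
    intro t
    have h1 : HasDerivAt (fun s => U (s - t) (ι (γ t))) (ι (A (γ t))) t := by
      have := hU.generator (γ t)
      rw [← sub_self t] at this
      exact this.comp_sub_const t t
    have h2 := (hγ t).sub h1
    rw [sub_self, hasDerivAt_iff_isLittleO] at h2
    rw [hasDerivAt_iff_isLittleO]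
    refine (h2.norm_left.congr_left fun s => ?_).of_norm_left
    simp only [smul_zero, sub_zero, Pi.sub_apply, sub_self, hU.map_zero,
      one_apply_eq_self]
    rw [← norm_apply_of_mem_unitary (hU.unitary s) (U (-s) _ - _), map_sub, hneg,
      ← mul_apply_eq_comp, ← hU.map_add, sub_eq_add_neg s t]
  have hc := is_const_of_deriv_eq_zero (fun t => (hd t).differentiableAt)
    (fun t => (hd t).deriv) t 0
  simp only [neg_zero, hU.map_zero, one_apply_eq_self] at hc
  rw [← hc, hneg]

/-- Uniqueness: solutions with a total set of initial values determine the group. -/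
theorem HasGenerator.eq_of_solutions {ι : E →ₗ[ℂ] H} {A : E → E} {U V : ℝ → (H →L[ℂ] H)}
    (hU : HasGenerator ι A U) (hV : HasGenerator ι A V) {u : I → E} {flow : ℝ → I → I}
    (hflow : ∀ i, IsSolution ι A fun t => u (flow t i)) (h0 : ∀ i, flow 0 i = i)
    (hdense : Dense (Submodule.span ℂ (Set.range fun i => ι (u i)) : Set H)) : U = V := by
  funext t
  refine ContinuousLinearMap.ext_on hdense ?_
  rintro _ ⟨i, rfl⟩
  have h1 := hU.apply_solution (hflow i) t
  have h2 := hV.apply_solution (hflow i) t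
  simp only [h0] at h1 h2
  exact h1.trans h2.symm

/-- Existence: if a skew-symmetric `A` has a total family of vectors `u i` whose orbits under the flow
solve the evolution equation, then `A` generates a unitary group. Since solutions keep their inner
products, `u i ↦ u (flow t i)` extends to a linear isometry `U t`; the integral formula
`U t f = f + ∫₀ᵗ U s (A f) ds` then gives the generator on all of `E`, not only on the `u i`. -/
theorem exists_hasGenerator {ι : E →ₗ[ℂ] H} {A : E → E}
    (hA : ∀ f g, ⟪ι (A f), ι g⟫_ℂ = -⟪ι f, ι (A g)⟫_ℂ) {u : I → E} {flow : ℝ → I → I}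
    (hflow : ∀ i, IsSolution ι A fun t => u (flow t i)) (h0 : ∀ i, flow 0 i = i)
    (hdense : Dense (Submodule.span ℂ (Set.range fun i => ι (u i)) : Set H)) :
    ∃ U, HasGenerator ι A U := by
  let L : ℝ → (I →₀ ℂ) →ₗ[ℂ] H := fun t => Finsupp.linearCombination ℂ fun i => ι (u (flow t i))
  have hL0 : L 0 = Finsupp.linearCombination ℂ fun i => ι (u i) := by simp only [L, h0]
  have hrange : DenseRange (L 0) := by
    rw [hL0]
    have := hdense
    rw [← Finsupp.range_linearCombination] at this
    rwa [DenseRange, ← LinearMap.coe_range]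
  have hnorm : ∀ t c, ‖L t c‖ = ‖L 0 c‖ := by
    intro t c
    have : ⟪L t c, L t c⟫_ℂ = ⟪L 0 c, L 0 c⟫_ℂ := by
      simp only [L, Finsupp.linearCombination_apply, Finsupp.sum_inner, Finsupp.inner_sum]
      simp only [inner_smul_left, inner_smul_right,
        fun i j => (hflow i).inner_eq hA (hflow j) t]
    rw [inner_self_eq_norm_sq_to_K, inner_self_eq_norm_sq_to_K] at this
    have h2 : ‖L t c‖ ^ 2 = ‖L 0 c‖ ^ 2 := by exact_mod_cast this
    exact (pow_left_inj₀ (norm_nonneg _) (norm_nonneg _) two_ne_zero).1 h2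
  let U : ℝ → (H →L[ℂ] H) := fun t => (L t).extendOfNorm (L 0)
  have hUL : ∀ t c, U t (L 0 c) = L t c := fun t c =>
    LinearMap.extendOfNorm_eq hrange ⟨1, fun c => by rw [one_mul, hnorm]⟩ c
  have hUu : ∀ t i, U t (ι (u i)) = ι (u (flow t i)) := by
    intro t i
    have := hUL t (Finsupp.single i 1)
    simpa [L, h0] using this
  have hUnorm : ∀ t x, ‖U t x‖ = ‖x‖ := by
    intro t
    refine fun x => hrange.induction_on (p := fun x => ‖U t x‖ = ‖x‖) x
      (isClosed_eq (by fun_prop) (by fun_prop)) fun c => ?_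
    rw [hUL, hnorm]
  have hext : ∀ V W : H →L[ℂ] H, (∀ i, V (ι (u i)) = W (ι (u i))) → V = W := by
    intro V W h
    refine ContinuousLinearMap.ext_on hdense ?_
    rintro _ ⟨i, rfl⟩
    exact h i
  have hzero : U 0 = 1 := hext _ _ fun i => by rw [hUu, h0]; rfl
  -- `s ↦ flow (s + t) i` and `s ↦ flow s (flow t i)` give solutions with the same initial value,
  -- so the group law of `flow` itself is not needed.
  have hadd : ∀ s t, U (s + t) = U s * U t := by
    intro s t
    refine hext _ _ fun i => ?_
    rw [mul_apply_eq_comp, hUu, hUu, hUu]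
    refine IsSolution.eq_of_initial_eq hA (γ := fun s => u (flow (s + t) i)) (fun r => ?_)
      (hflow (flow t i)) (by simp [h0]) s
    exact (hflow i (r + t)).comp_add_const r t
  have hinner : ∀ t x y, ⟪U t x, U t y⟫_ℂ = ⟪x, y⟫_ℂ := fun t =>
    (LinearMap.norm_map_iff_inner_map_map (U t)).1 (hUnorm t)
  have hunit : ∀ t, U t ∈ unitary (H →L[ℂ] H) := by
    intro t
    have h1 : star (U t) * U t = 1 :=
      (ContinuousLinearMap.norm_map_iff_adjoint_comp_self (U t)).1 (hUnorm t)
    have h2 : U t * U (-t) = 1 := by rw [← hadd, add_neg_cancel, hzero]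
    refine ⟨h1, ?_⟩
    rw [left_inv_eq_right_inv h1 h2, h2]
  have hcont : ∀ x : H, Continuous fun t => U t x := by
    have hc : ∀ c, Continuous fun t => U t (L 0 c) := by
      intro c
      simp only [hUL]
      simp only [L, Finsupp.linearCombination_apply, Finsupp.sum]
      refine continuous_finsetSum _ fun i _ => Continuous.const_smul ?_ _
      exact continuous_iff_continuousAt.2 fun t => (hflow i t).continuousAt
    intro x
    rw [Metric.continuous_iff']
    intro t ε hε
    obtain ⟨c, hxc⟩ := hrange.exists_dist_lt x (ε := ε / 3) (by positivity)
    filter_upwards [Metric.continuous_iff'.1 (hc c) t (ε / 3) (by positivity)] with s hs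
    have h1 : ∀ r, dist (U r x) (U r (L 0 c)) < ε / 3 := fun r => by
      rwa [dist_eq_norm, ← map_sub, hUnorm, ← dist_eq_norm]
    have := dist_triangle4 (U s x) (U s (L 0 c)) (U t (L 0 c)) (U t x)
    have h2 := h1 t
    rw [dist_comm] at h2
    linarith [h1 s]
  refine ⟨U, hunit, hzero, hadd, hcont, fun f => ?_⟩
  -- The identity `U t f = f + ∫ U s (A f)` holds after pairing with each `u i`.
  have hint : ∀ t, HasDerivAt (fun t => ∫ s in (0 : ℝ)..t, U s (ι (A f))) (U t (ι (A f))) t :=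
    fun t => (hcont _).integral_hasStrictDerivAt 0 t |>.hasDerivAt
  have hadj : ∀ t x y, ⟪x, U t y⟫_ℂ = ⟪U (-t) x, y⟫_ℂ := by
    intro t x y
    rw [← hinner t (U (-t) x), ← mul_apply_eq_comp, ← hadd, add_neg_cancel, hzero]
    rfl
  have hpair : ∀ i t, HasDerivAt
      (fun t => ⟪ι (u i), U t (ι f) - ∫ s in (0 : ℝ)..t, U s (ι (A f))⟫_ℂ) 0 t := by
    intro i t
    have h1 : HasDerivAt (fun t => ⟪ι (u i), U t (ι f)⟫_ℂ) ⟪ι (u i), U t (ι (A f))⟫_ℂ t := by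
      simp only [hadj, hUu]
      have h3 := ((hflow i (-t)).scomp t (hasDerivAt_neg t)).inner ℂ (hasDerivAt_const t (ι f))
      refine h3.congr_deriv ?_
      rw [inner_zero_right, zero_add, neg_smul, one_smul, inner_neg_left, hA, neg_neg]
    have h2 := (hasDerivAt_const t (ι (u i))).inner ℂ (hint t)
    simp only [inner_sub_right]
    refine (h1.sub h2).congr_deriv ?_
    rw [inner_zero_left, add_zero, sub_self]
  have hduhamel : ∀ t, U t (ι f) = ι f + ∫ s in (0 : ℝ)..t, U s (ι (A f)) := by
    intro t
    have h1 : innerSL ℂ (U t (ι f) - ∫ s in (0 : ℝ)..t, U s (ι (A f))) = innerSL ℂ (ι f) := by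
      refine ContinuousLinearMap.ext_on hdense ?_
      rintro _ ⟨i, rfl⟩
      have := is_const_of_deriv_eq_zero (fun t => (hpair i t).differentiableAt)
        (fun t => (hpair i t).deriv) t 0
      simp only [intervalIntegral.integral_same, sub_zero, hzero,
        one_apply_eq_self] at this
      simp only [innerSL_apply_apply]
      rw [← inner_conj_symm, this, inner_conj_symm]
    have h2 : U t (ι f) - ∫ s in (0 : ℝ)..t, U s (ι (A f)) = ι f := by
      refine ext_inner_right ℂ fun v => ?_
      exact congrArg (fun T => T v) h1
    exact sub_eq_iff_eq_add.1 h2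
  simp only [hduhamel]
  have := (hint 0).const_add (ι f)
  simpa [hzero] using this

end AbstractGroup

/-! ### Reproducing families of vectors -/

section Reproducing

variable {H X : Type*} [NormedAddCommGroup H] [InnerProductSpace ℂ H]

/-- The closed linear span of a family of vectors. -/
def closedSpan (v : X → H) : Submodule ℂ H :=
  (Submodule.span ℂ (Set.range v)).topologicalClosure

instance [CompleteSpace H] (v : X → H) : CompleteSpace (closedSpan v) :=
  (Submodule.isClosed_topologicalClosure _).completeSpace_coe

theorem mem_closedSpan (v : X → H) (x : X) : v x ∈ closedSpan v :=
  Submodule.le_topologicalClosure _ (Submodule.subset_span ⟨x, rfl⟩)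

theorem inner_starProjection_closedSpan [CompleteSpace H] (v : X → H) (x : X) (f : H) :
    ⟪v x, (closedSpan v).starProjection f⟫_ℂ = ⟪v x, f⟫_ℂ := by
  rw [← Submodule.inner_starProjection_left_eq_right,
    Submodule.starProjection_eq_self_iff.2 (mem_closedSpan v x)]

variable [MeasurableSpace X] {μ : Measure X} {v : X → H} {c : ℝ}

/-- The Gram kernel of the family `v` reproduces itself up to the factor `c`:
`∫ ⟪v x, v y⟫ ⟪v y, v z⟫ dμ(y) = c ⟪v x, v z⟫`. -/
structure IsReproducing (μ : Measure X) (v : X → H) (c : ℝ) : Prop where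
  measurable : ∀ f : H, AEStronglyMeasurable (fun x => ⟪v x, f⟫_ℂ) μ
  integrable : ∀ x z, Integrable (fun y => ⟪v x, v y⟫_ℂ * ⟪v y, v z⟫_ℂ) μ
  integral_eq : ∀ x z, ∫ y, ⟪v x, v y⟫_ℂ * ⟪v y, v z⟫_ℂ ∂μ = c * ⟪v x, v z⟫_ℂ

theorem IsReproducing.integrable_of_mem_span (h : IsReproducing μ v c) {f g : H}
    (hf : f ∈ Submodule.span ℂ (Set.range v)) (hg : g ∈ Submodule.span ℂ (Set.range v)) :
    Integrable (fun y => ⟪f, v y⟫_ℂ * ⟪v y, g⟫_ℂ) μ ∧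
      ∫ y, ⟪f, v y⟫_ℂ * ⟪v y, g⟫_ℂ ∂μ = c * ⟪f, g⟫_ℂ := by
  have h1 : ∀ x, Integrable (fun y => ⟪v x, v y⟫_ℂ * ⟪v y, g⟫_ℂ) μ ∧
      ∫ y, ⟪v x, v y⟫_ℂ * ⟪v y, g⟫_ℂ ∂μ = c * ⟪v x, g⟫_ℂ := by
    intro x
    induction hg using Submodule.span_induction with
    | mem g hg => obtain ⟨z, rfl⟩ := hg; exact ⟨h.integrable x z, h.integral_eq x z⟩
    | zero => simp
    | add a b _ _ ha hb =>
      simp only [inner_add_right, mul_add]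
      exact ⟨ha.1.add hb.1, by rw [integral_add ha.1 hb.1, ha.2, hb.2]⟩
    | smul k a _ ha =>
      simp only [inner_smul_right, mul_left_comm _ k]
      exact ⟨ha.1.const_mul k, by rw [integral_const_mul, ha.2]⟩
  induction hf using Submodule.span_induction with
  | mem f hf => obtain ⟨x, rfl⟩ := hf; exact h1 x
  | zero => simp
  | add a b _ _ ha hb =>
    simp only [inner_add_left, mul_add, add_mul]
    exact ⟨ha.1.add hb.1, by rw [integral_add ha.1 hb.1, ha.2, hb.2]⟩
  | smul k a _ ha =>
    simp only [inner_smul_left, mul_assoc, mul_left_comm _ (conj k)]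
    exact ⟨ha.1.const_mul _, by rw [integral_const_mul, ha.2]⟩

/-- On the span of the family, the analysis map `f ↦ ⟪v ·, f⟫` is `√c` times an isometry into `L²(μ)`. -/
theorem IsReproducing.eLpNorm_of_mem_span (h : IsReproducing μ v c) {f : H}
    (hf : f ∈ Submodule.span ℂ (Set.range v)) :
    eLpNorm (fun y => ⟪v y, f⟫_ℂ) 2 μ = ENNReal.ofReal (Real.sqrt c * ‖f‖) := by
  obtain ⟨h1, h2⟩ := h.integrable_of_mem_span hf hf
  have hsq : ∀ y, ⟪f, v y⟫_ℂ * ⟪v y, f⟫_ℂ = ((‖⟪v y, f⟫_ℂ‖ ^ 2 : ℝ) : ℂ) := fun y => by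
    rw [← inner_conj_symm, Complex.conj_mul']; push_cast; rfl
  simp only [hsq] at h1 h2
  rw [integral_complex_ofReal, inner_self_eq_norm_sq_to_K] at h2
  have h3 : ∫ y, ‖⟪v y, f⟫_ℂ‖ ^ 2 ∂μ = c * ‖f‖ ^ 2 :=
    Complex.ofReal_injective (h2.trans (by push_cast; rfl))
  have hm : MemLp (fun y => ⟪v y, f⟫_ℂ) 2 μ :=
    (memLp_two_iff_integrable_sq_norm (h.measurable f)).2 (by exact_mod_cast h1.re)
  rw [hm.eLpNorm_eq_integral_rpow_norm two_ne_zero ENNReal.ofNat_ne_top]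
  simp only [ENNReal.toReal_ofNat, Real.rpow_ofNat, h3]
  rw [show ((2 : ℝ)⁻¹) = 1 / 2 by norm_num, ← Real.sqrt_eq_rpow, Real.sqrt_mul' _ (sq_nonneg _),
    Real.sqrt_sq (norm_nonneg f)]

/-- By Fatou's lemma the bound on the analysis map passes to the closed span. -/
theorem IsReproducing.eLpNorm_le (h : IsReproducing μ v c) {f : H} (hf : f ∈ closedSpan v) :
    eLpNorm (fun y => ⟪v y, f⟫_ℂ) 2 μ ≤ ENNReal.ofReal (Real.sqrt c * ‖f‖) := by
  obtain ⟨u, hu, hlim⟩ := mem_closure_iff_seq_limit.1 hf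
  refine (Lp.eLpNorm_lim_le_liminf_eLpNorm (fun n => h.measurable (u n)) _
    (Filter.Eventually.of_forall fun y => ?_)).trans ?_
  · exact ((continuous_const.inner continuous_id).tendsto f).comp hlim
  · simp only [fun n => h.eLpNorm_of_mem_span (hu n)]
    refine (Filter.Tendsto.liminf_eq ?_).le
    exact (ENNReal.continuous_ofReal.tendsto _).comp (hlim.norm.const_mul _)

variable [CompleteSpace H]

theorem IsReproducing.memLp (h : IsReproducing μ v c) (f : H) :
    MemLp (fun y => ⟪v y, f⟫_ℂ) 2 μ := by
  refine ⟨h.measurable f, ?_⟩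
  simp only [← inner_starProjection_closedSpan v _ f]
  exact (h.eLpNorm_le (Submodule.starProjection_apply_mem _ f)).trans_lt ENNReal.ofReal_lt_top

/-- A reproducing family resolves the orthogonal projection onto its closed span: weakly,
`∫ |v y⟩⟨v y| dμ(y) = c P`. -/
theorem IsReproducing.resolution (h : IsReproducing μ v c) (f g : H) :
    Integrable (fun y => ⟪f, v y⟫_ℂ * ⟪v y, g⟫_ℂ) μ ∧
      ∫ y, ⟪f, v y⟫_ℂ * ⟪v y, g⟫_ℂ ∂μ = c * ⟪f, (closedSpan v).starProjection g⟫_ℂ := by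
  let T : H →ₗ[ℂ] Lp ℂ 2 μ :=
    { toFun := fun f => (h.memLp f).toLp
      map_add' := fun f g => by
        rw [← MemLp.toLp_add]
        exact MemLp.toLp_congr _ _ (Filter.Eventually.of_forall fun y => inner_add_right _ _ _)
      map_smul' := fun k f => by
        rw [RingHom.id_apply, ← MemLp.toLp_const_smul]
        exact MemLp.toLp_congr _ _ (Filter.Eventually.of_forall fun y => inner_smul_right _ _ _) }
  have hTP : ∀ f, T ((closedSpan v).starProjection f) = T f := fun f =>
    MemLp.toLp_congr (h.memLp _) (h.memLp f) (Filter.Eventually.of_forall fun y =>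
      inner_starProjection_closedSpan v y f)
  have hTnorm : ∀ f, ‖T f‖ ≤ Real.sqrt c * ‖f‖ := by
    intro f
    rw [← hTP]
    refine le_trans ?_ (mul_le_mul_of_nonneg_left
      ((closedSpan v).norm_starProjection_apply_le f) (Real.sqrt_nonneg c))
    refine (Lp.norm_toLp _ (h.memLp _)).trans_le ?_
    exact ENNReal.toReal_le_of_le_ofReal (by positivity)
      (h.eLpNorm_le (Submodule.starProjection_apply_mem _ f))
  let T' : H →L[ℂ] Lp ℂ 2 μ := T.mkContinuous _ hTnorm
  have hprod : ∀ f g y, ⟪⟪v y, f⟫_ℂ, ⟪v y, g⟫_ℂ⟫_ℂ = ⟪f, v y⟫_ℂ * ⟪v y, g⟫_ℂ := fun f g y => by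
    rw [RCLike.inner_apply, inner_conj_symm, mul_comm]
  have hae : ∀ f g, (fun y => ⟪T f y, T g y⟫_ℂ) =ᵐ[μ] fun y => ⟪f, v y⟫_ℂ * ⟪v y, g⟫_ℂ := by
    intro f g
    filter_upwards [(h.memLp f).coeFn_toLp, (h.memLp g).coeFn_toLp] with y h1 h2
    rw [← hprod]
    exact congrArg₂ _ h1 h2
  have hTint : ∀ f g, ⟪T' f, T' g⟫_ℂ = ∫ y, ⟪f, v y⟫_ℂ * ⟪v y, g⟫_ℂ ∂μ := fun f g =>
    integral_congr_ae (hae f g)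
  refine ⟨(L2.integrable_inner (𝕜 := ℂ) (T f) (T g)).congr (hae f g), ?_⟩
  have h1 : ∀ g ∈ Submodule.span ℂ (Set.range v), ∀ f ∈ closedSpan v,
      ⟪T' f, T' g⟫_ℂ = c * ⟪f, g⟫_ℂ := by
    intro g hg
    refine closure_minimal (t := {f | ⟪T' f, T' g⟫_ℂ = c * ⟪f, g⟫_ℂ}) (fun f hf => ?_)
      (isClosed_eq (by fun_prop) (by fun_prop))
    exact (hTint f g).trans (h.integrable_of_mem_span hf hg).2
  have h2 : ∀ f ∈ closedSpan v, ∀ g ∈ closedSpan v, ⟪T' f, T' g⟫_ℂ = c * ⟪f, g⟫_ℂ := by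
    intro f hf
    exact closure_minimal (t := {g | ⟪T' f, T' g⟫_ℂ = c * ⟪f, g⟫_ℂ}) (fun g hg => h1 g hg f hf)
      (isClosed_eq (by fun_prop) (by fun_prop))
  have h3 : ∀ f, T' ((closedSpan v).starProjection f) = T' f := hTP
  rw [← hTint, ← h3 f, ← h3 g, h2 _ (Submodule.starProjection_apply_mem _ f) _
    (Submodule.starProjection_apply_mem _ g), Submodule.inner_starProjection_left_eq_right,
    Submodule.starProjection_eq_self_iff.2 (Submodule.starProjection_apply_mem _ g)]

end Reproducing

/-! ### Uniqueness of Fourier transforms -/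

section FourierUniqueness

variable {Ω F : Type*} [MeasurableSpace Ω] {ν : Measure Ω}
  [NormedAddCommGroup F] [NormedSpace ℝ F] [CompleteSpace F] [MeasurableSpace F] [BorelSpace F]
  [SecondCountableTopology F]

/-- The real case: positive and negative part of the density, pushed forward under `X`, are finite
measures with the same characteristic function. -/
theorem integral_mul_comp_eq_zero_of_real {X : Ω → F} (hX : Measurable X) {h : Ω → ℝ}
    (hh : Integrable h ν)
    (h0 : ∀ L : StrongDual ℝ F, ∫ ω, (h ω : ℂ) * Complex.exp (L (X ω) * Complex.I) ∂ν = 0)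
    {φ : F → ℂ} (hφ : Measurable φ) (hi : Integrable (fun ω => (h ω : ℂ) * φ (X ω)) ν) :
    ∫ ω, (h ω : ℂ) * φ (X ω) ∂ν = 0 := by
  have hn : Integrable (fun ω => -h ω) ν := hh.neg
  let m : (Ω → ℝ) → Measure F := fun k => (ν.withDensity fun ω => ENNReal.ofReal (k ω)).map X
  have hint : ∀ k : Ω → ℝ, Integrable k ν → ∀ ψ : F → ℂ, Measurable ψ →
      ∫ x, ψ x ∂(m k) = ∫ ω, ((max (k ω) 0 : ℝ) : ℂ) * ψ (X ω) ∂ν := by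
    intro k hk ψ hψ
    rw [integral_map hX.aemeasurable hψ.aestronglyMeasurable,
      integral_withDensity_eq_integral_toReal_smul₀ hk.aestronglyMeasurable.aemeasurable.ennreal_ofReal
        (Filter.Eventually.of_forall fun _ => ENNReal.ofReal_lt_top)]
    simp only [ENNReal.toReal_ofReal', Complex.real_smul]
  have hsplit : ∀ ψ : F → ℂ, Measurable ψ → Integrable (fun ω => (h ω : ℂ) * ψ (X ω)) ν →
      ∫ ω, (h ω : ℂ) * ψ (X ω) ∂ν = ∫ x, ψ x ∂(m h) - ∫ x, ψ x ∂(m fun ω => -h ω) := by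
    intro ψ hψ hψi
    have hmeas : ∀ k : Ω → ℝ, Integrable k ν → AEStronglyMeasurable
        (fun ω => ((max (k ω) 0 : ℝ) : ℂ) * ψ (X ω)) ν := fun k hk =>
      (Complex.continuous_ofReal.comp_aestronglyMeasurable
        hk.pos_part.aestronglyMeasurable).mul (hψ.comp hX).aestronglyMeasurable
    have hle : ∀ k : Ω → ℝ, Integrable k ν → (∀ ω, |k ω| = |h ω|) → Integrable
        (fun ω => ((max (k ω) 0 : ℝ) : ℂ) * ψ (X ω)) ν := by
      intro k hk hkh
      refine hψi.mono (hmeas k hk) (Filter.Eventually.of_forall fun ω => ?_)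
      rw [norm_mul, norm_mul, Complex.norm_real, Complex.norm_real]
      refine mul_le_mul_of_nonneg_right ?_ (norm_nonneg _)
      rw [Real.norm_eq_abs, Real.norm_eq_abs, ← hkh, abs_of_nonneg (le_max_right _ _)]
      exact max_le (le_abs_self _) (abs_nonneg _)
    rw [hint h hh ψ hψ, hint _ hn ψ hψ, ← integral_sub (hle h hh fun _ => rfl)
      (hle _ hn fun ω => abs_neg _)]
    refine integral_congr_ae (Filter.Eventually.of_forall fun ω => ?_)
    simp only
    rw [← sub_mul, ← Complex.ofReal_sub, max_zero_sub_max_neg_zero_eq_self]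
  have hfin : ∀ k : Ω → ℝ, Integrable k ν → IsFiniteMeasure (m k) := by
    intro k hk
    have : IsFiniteMeasure (ν.withDensity fun ω => ENNReal.ofReal (k ω)) :=
      isFiniteMeasure_withDensity_ofReal hk.2
    infer_instance
  have h1 := hfin h hh
  have h2 := hfin _ hn
  have heq : m h = m fun ω => -h ω := by
    refine Measure.ext_of_charFunDual (funext fun L => ?_)
    have hm : Measurable fun x : F => Complex.exp (L x * Complex.I) := by fun_prop
    have := hsplit _ hm (hh.ofReal.mul_bdd (c := 1)
      (hm.comp hX).aestronglyMeasurable (Filter.Eventually.of_forall fun ω => by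
        simp [Complex.norm_exp]))
    rw [h0 L] at this
    exact (sub_eq_zero.1 this.symm)
  rw [hsplit φ hφ hi, ← heq, sub_self]

/-- If the image of the complex measure `h ν` under `X` has vanishing Fourier transform, then `h` is
orthogonal to every function of `X`, bounded or not. -/
theorem integral_mul_comp_eq_zero {X : Ω → F} (hX : Measurable X) {h : Ω → ℂ}
    (hh : Integrable h ν)
    (h0 : ∀ L : StrongDual ℝ F, ∫ ω, h ω * Complex.exp (L (X ω) * Complex.I) ∂ν = 0)
    {φ : F → ℂ} (hφ : Measurable φ) (hi : Integrable (fun ω => h ω * φ (X ω)) ν) :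
    ∫ ω, h ω * φ (X ω) ∂ν = 0 := by
  have hexp : ∀ L : StrongDual ℝ F, AEStronglyMeasurable
      (fun ω => Complex.exp (L (X ω) * Complex.I)) ν := fun L =>
    (Measurable.comp (g := fun x : F => Complex.exp (L x * Complex.I)) (by fun_prop)
      hX).aestronglyMeasurable
  have hmul : ∀ k : Ω → ℂ, Integrable k ν → ∀ L : StrongDual ℝ F, Integrable
      (fun ω => k ω * Complex.exp (L (X ω) * Complex.I)) ν := fun k hk L =>
    hk.mul_bdd (c := 1) (hexp L) (Filter.Eventually.of_forall fun ω => by simp [Complex.norm_exp])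
  have hconj : ∀ L : StrongDual ℝ F,
      ∫ ω, conj (h ω) * Complex.exp (L (X ω) * Complex.I) ∂ν = 0 := by
    intro L
    have := congrArg conj (h0 (-L))
    rw [map_zero, ← integral_conj] at this
    rw [← this]
    refine integral_congr_ae (Filter.Eventually.of_forall fun ω => ?_)
    simp [← Complex.exp_conj]
  have hcint : Integrable (fun ω => conj (h ω)) ν :=
    (LinearIsometryEquiv.integrable_comp_iff (L := Complex.conjLIE) (φ := h)).2 hh
  have hre : ∀ ω, ((h ω).re : ℂ) = (1 / 2) * (h ω + conj (h ω)) := fun ω => by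
    rw [Complex.add_conj]; push_cast; ring
  have him : ∀ ω, ((h ω).im : ℂ) = (-Complex.I / 2) * (h ω - conj (h ω)) := fun ω => by
    rw [Complex.sub_conj]; push_cast; linear_combination ((h ω).im : ℂ) * Complex.I_sq
  have hle : ∀ k : Ω → ℝ, Integrable k ν → (∀ ω, |k ω| ≤ ‖h ω‖) →
      Integrable (fun ω => (k ω : ℂ) * φ (X ω)) ν := by
    intro k hk hkh
    refine hi.mono (hk.ofReal.aestronglyMeasurable.mul (hφ.comp hX).aestronglyMeasurable)
      (Filter.Eventually.of_forall fun ω => ?_)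
    rw [norm_mul, norm_mul, Complex.norm_real]
    exact mul_le_mul_of_nonneg_right (hkh ω) (norm_nonneg _)
  have hire := hle _ hh.re fun ω => Complex.abs_re_le_norm _
  have hiim := hle _ hh.im fun ω => Complex.abs_im_le_norm _
  have h1 := integral_mul_comp_eq_zero_of_real hX hh.re (fun L => by
    simp only [RCLike.re_to_complex, hre, mul_assoc, add_mul]
    rw [integral_const_mul, integral_add (hmul h hh L) (hmul _ hcint L), h0, hconj, add_zero,
      mul_zero]) hφ hire
  have h2 := integral_mul_comp_eq_zero_of_real hX hh.im (fun L => by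
    simp only [RCLike.im_to_complex, him, mul_assoc, sub_mul]
    rw [integral_const_mul, integral_sub (hmul h hh L) (hmul _ hcint L), h0, hconj, sub_zero,
      mul_zero]) hφ hiim
  have h3 : ∀ ω, h ω * φ (X ω)
      = ((RCLike.re (h ω) : ℝ) : ℂ) * φ (X ω) + Complex.I * (((RCLike.im (h ω) : ℝ) : ℂ) * φ (X ω)) := by
    intro ω
    conv_lhs => rw [← Complex.re_add_im (h ω)]
    simp only [RCLike.re_to_complex, RCLike.im_to_complex]
    ring
  simp only [h3]
  rw [integral_add hire (hiim.const_mul _), integral_const_mul, h1, h2, mul_zero, add_zero]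

end FourierUniqueness

/-! ### Exponentials as Schwartz functions -/

section SchwartzExp

theorem exists_one_add_pow_mul_exp_le (k : ℕ) {ε : ℝ} (hε : 0 < ε) :
    ∃ C, ∀ x : ℝ, 0 ≤ x → (1 + x) ^ k * Real.exp (-ε * x ^ 2) ≤ C := by
  refine ⟨(2 / ε) ^ k * (k.factorial * Real.exp ε), fun x hx => ?_⟩
  have h1 : (1 + x) ^ k ≤ (2 / ε) ^ k * (ε * (1 + x ^ 2)) ^ k := by
    rw [← mul_pow]
    refine pow_le_pow_left₀ (by positivity) ?_ k
    rw [show 2 / ε * (ε * (1 + x ^ 2)) = 2 * (1 + x ^ 2) by field_simp]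
    nlinarith [sq_nonneg (x - 1)]
  have h2 : (ε * (1 + x ^ 2)) ^ k ≤ k.factorial * Real.exp (ε * (1 + x ^ 2)) := by
    have := Real.pow_div_factorial_le_exp (ε * (1 + x ^ 2)) (by positivity) k
    rwa [div_le_iff₀' (by positivity)] at this
  calc (1 + x) ^ k * Real.exp (-ε * x ^ 2)
      ≤ (2 / ε) ^ k * (k.factorial * Real.exp (ε * (1 + x ^ 2))) * Real.exp (-ε * x ^ 2) := by
        gcongr
        exact h1.trans (by gcongr)
    _ = _ := by
        rw [mul_assoc, mul_assoc, ← Real.exp_add]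
        congr 3
        ring_nf

theorem norm_iteratedFDeriv_cexp (n : ℕ) (z : ℂ) :
    ‖iteratedFDeriv ℝ n Complex.exp z‖ = Real.exp z.re := by
  rw [← (Complex.contDiff_exp (𝕜 := ℂ) (n := n)).contDiffAt.restrictScalars_iteratedFDeriv
    (𝕜 := ℝ)]
  simp only [Function.comp_apply, ContinuousMultilinearMap.norm_restrictScalars]
  rw [norm_iteratedFDeriv_eq_norm_iteratedDeriv, iteratedDeriv_eq_iterate, Complex.iter_deriv_exp,
    Complex.norm_exp]

variable {E : Type*} [NormedAddCommGroup E] [NormedSpace ℝ E]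

/-- The function `exp ∘ q` is a Schwartz function when `q` has temperate growth and its real part lies
below a negative definite quadratic. -/
def schwartzExp (q : E → ℂ) (hq : q.HasTemperateGrowth) {K ε : ℝ} (hε : 0 < ε)
    (hqre : ∀ z, (q z).re ≤ K - ε * ‖z‖ ^ 2) : 𝓢(E, ℂ) where
  toFun z := Complex.exp (q z)
  smooth' := hq.1.cexp
  decay' k n := by
    obtain ⟨N, C, hC, hb⟩ := hq.norm_iteratedFDeriv_le_uniform n
    obtain ⟨M, hM⟩ := exists_one_add_pow_mul_exp_le (k + N * n) hε
    refine ⟨n.factorial * Real.exp K * (C + 1) ^ n * M, fun z => ?_⟩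
    set y := 1 + ‖z‖ with hy
    have hy1 : 1 ≤ y := by simp [hy]
    have hD : 1 ≤ (C + 1) * y ^ N := by
      have := one_le_pow₀ (n := N) hy1
      nlinarith
    have h1 := norm_iteratedFDeriv_comp_le (𝕜 := ℝ) (g := Complex.exp) (f := q) (n := n) (N := n)
      Complex.contDiff_exp (hq.1.of_le (by exact_mod_cast le_top)) le_rfl z
      (C := Real.exp (q z).re) (D := (C + 1) * y ^ N)
      (fun i _ => (norm_iteratedFDeriv_cexp i (q z)).le)
      (fun i hi hin => (hb i hin z).trans (le_trans (by gcongr; linarith)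
        (le_self_pow₀ hD (by omega))))
    calc ‖z‖ ^ k * ‖iteratedFDeriv ℝ n (fun z => Complex.exp (q z)) z‖
        ≤ y ^ k * (n.factorial * Real.exp (K - ε * ‖z‖ ^ 2) * ((C + 1) * y ^ N) ^ n) := by
          gcongr
          · simp [hy]
          · exact h1.trans (by gcongr; exact hqre z)
      _ = n.factorial * Real.exp K * (C + 1) ^ n
            * (y ^ (k + N * n) * Real.exp (-ε * ‖z‖ ^ 2)) := by
          rw [sub_eq_add_neg, Real.exp_add, mul_pow, pow_add, pow_mul, neg_mul]
          ring
      _ ≤ _ := by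
          gcongr
          exact hM _ (norm_nonneg z)

end SchwartzExp

/-- Differentiation in `L²` of a path of Schwartz functions: a pointwise derivative that is dominated
near `t₀` by a Schwartz function is a derivative in the norm of `L²`. -/
theorem hasDerivAt_toLp_of_dominated {E : Type*} [NormedAddCommGroup E] [NormedSpace ℝ E]
    [MeasurableSpace E] [BorelSpace E] [SecondCountableTopology E] (μ : Measure E)
    [μ.HasTemperateGrowth] {F : ℝ → 𝓢(E, ℂ)} {f' : ℝ → E → ℂ} {t₀ : ℝ} {G : 𝓢(E, ℂ)}
    (hG : ∀ z, G z = f' t₀ z)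
    (hF : ∀ t ∈ Metric.ball t₀ 1, ∀ z, HasDerivAt (fun t => F t z) (f' t z) t) {b : 𝓢(E, ℂ)}
    (hb : ∀ t ∈ Metric.ball t₀ 1, ∀ z, ‖f' t z‖ ≤ ‖b z‖) :
    HasDerivAt (fun t => (F t).toLp 2 μ) (G.toLp 2 μ) t₀ := by
  rw [hasDerivAt_iff_tendsto]
  let R : ℝ → 𝓢(E, ℂ) := fun t => F t - F t₀ - (t - t₀) • G
  have hR : ∀ t, ‖t - t₀‖⁻¹ * ‖(F t).toLp 2 μ - (F t₀).toLp 2 μ - (t - t₀) • G.toLp 2 μ‖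
      = (∫ z, (‖t - t₀‖⁻¹ * ‖R t z‖) ^ 2 ∂μ) ^ (1 / 2 : ℝ) := by
    intro t
    have h1 : (F t).toLp 2 μ - (F t₀).toLp 2 μ - (t - t₀) • G.toLp 2 μ = (R t).toLp 2 μ := by
      have : (R t).toLp 2 μ = toLpCLM ℝ ℂ 2 μ (R t) := rfl
      rw [this, map_sub, map_sub, map_smul]
      rfl
    rw [h1, norm_toLp' two_ne_zero ENNReal.ofNat_ne_top]
    simp only [ENNReal.toReal_ofNat, Real.rpow_ofNat, mul_pow]
    rw [integral_const_mul, Real.mul_rpow (by positivity) (integral_nonneg fun _ => by positivity),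
      ← Real.sqrt_eq_rpow, Real.sqrt_sq (by positivity), one_div]
  simp only [hR]
  rw [show (0 : ℝ) = (∫ _ : E, (0 : ℝ) ∂μ) ^ (1 / 2 : ℝ) by simp]
  refine Filter.Tendsto.rpow_const ?_ (Or.inr (by norm_num))
  have hball : Metric.ball t₀ 1 ∈ nhds t₀ := Metric.ball_mem_nhds _ one_pos
  have hmvt : ∀ t ∈ Metric.ball t₀ 1, ∀ z, ‖F t z - F t₀ z‖ ≤ ‖b z‖ * ‖t - t₀‖ := fun t ht z =>
    (convex_ball t₀ 1).norm_image_sub_le_of_norm_hasDerivWithin_le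
      (fun x hx => (hF x hx z).hasDerivWithinAt) (fun x hx => hb x hx z)
      (Metric.mem_ball_self one_pos) ht
  refine tendsto_integral_filter_of_dominated_convergence (fun z => (2 * ‖b z‖) ^ 2)
    (Filter.Eventually.of_forall fun t => ?_) ?_ ?_ (Filter.Eventually.of_forall fun z => ?_)
  · exact (((R t).continuous.norm.const_mul _).pow 2).aestronglyMeasurable
  · filter_upwards [hball] with t ht
    refine Filter.Eventually.of_forall fun z => ?_
    rw [Real.norm_of_nonneg (by positivity)]
    refine pow_le_pow_left₀ (by positivity) ?_ 2
    refine inv_mul_le_of_le_mul₀ (norm_nonneg _) (by positivity) ?_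
    have h1 : R t z = (F t z - F t₀ z) - (t - t₀) • f' t₀ z := by
      simp [R, ← hG]
    rw [h1]
    refine (norm_sub_le _ _).trans ?_
    rw [norm_smul]
    have h2 := hmvt t ht z
    have h3 := mul_le_mul_of_nonneg_left (hb t₀ (Metric.mem_ball_self one_pos) z)
      (norm_nonneg (t - t₀))
    linarith
  · have := (memLp_two_iff_integrable_sq_norm b.continuous.aestronglyMeasurable).1 (b.memLp 2 μ)
    simp only [mul_pow]
    exact this.const_mul _
  · have h1 := hasDerivAt_iff_tendsto.1 (hF t₀ (Metric.mem_ball_self one_pos) z)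
    have h2 := h1.pow 2
    rw [zero_pow two_ne_zero] at h2
    refine h2.congr fun t => ?_
    simp [R, ← hG]

/-! ### Centre-of-mass and relative coordinates -/

section Coordinates

theorem fourthRoot_sq : ((2 : ℝ) ^ (1 / 4 : ℝ)) ^ 2 = Real.sqrt 2 := by
  rw [← Real.rpow_natCast, ← Real.rpow_mul (by norm_num), Real.sqrt_eq_rpow]
  norm_num

theorem fourthRoot_pos : (0 : ℝ) < (2 : ℝ) ^ (1 / 4 : ℝ) := by positivity

/-- The normalized centre-of-mass coordinate `s = (x + y) / 2^{1/4}`. -/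
def centerCoord : (ℝ × ℝ) →L[ℝ] ℝ :=
  ((2 : ℝ) ^ (1 / 4 : ℝ))⁻¹ • (ContinuousLinearMap.fst ℝ ℝ ℝ + ContinuousLinearMap.snd ℝ ℝ ℝ)

/-- The normalized relative coordinate `w = (x - y) / 2^{1/4}`. -/
def relCoord : (ℝ × ℝ) →L[ℝ] ℝ :=
  ((2 : ℝ) ^ (1 / 4 : ℝ))⁻¹ • (ContinuousLinearMap.fst ℝ ℝ ℝ - ContinuousLinearMap.snd ℝ ℝ ℝ)

theorem centerCoord_apply (z : ℝ × ℝ) :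
    centerCoord z = (z.1 + z.2) / (2 : ℝ) ^ (1 / 4 : ℝ) := by
  simp [centerCoord, div_eq_inv_mul, mul_add]

theorem relCoord_apply (z : ℝ × ℝ) : relCoord z = (z.1 - z.2) / (2 : ℝ) ^ (1 / 4 : ℝ) := by
  simp [relCoord, div_eq_inv_mul]

theorem centerCoord_sq_add_relCoord_sq (z : ℝ × ℝ) :
    centerCoord z ^ 2 + relCoord z ^ 2 = Real.sqrt 2 * (z.1 ^ 2 + z.2 ^ 2) := by
  have h2 : Real.sqrt 2 * Real.sqrt 2 = 2 := Real.mul_self_sqrt (by norm_num)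
  rw [centerCoord_apply, relCoord_apply, div_pow, div_pow, fourthRoot_sq]
  field_simp
  linear_combination (-(z.1 ^ 2 + z.2 ^ 2)) * h2

theorem norm_sq_le_coords (z : ℝ × ℝ) : ‖z‖ ^ 2 ≤ centerCoord z ^ 2 + relCoord z ^ 2 := by
  rw [centerCoord_sq_add_relCoord_sq]
  have h1 : (1 : ℝ) ≤ Real.sqrt 2 := Real.one_le_sqrt.2 (by norm_num)
  have h2 : ‖z‖ ^ 2 ≤ z.1 ^ 2 + z.2 ^ 2 := by
    rw [Prod.norm_def]
    rcases max_cases ‖z.1‖ ‖z.2‖ with ⟨h, -⟩ | ⟨h, -⟩ <;>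
      rw [h, Real.norm_eq_abs, sq_abs] <;> nlinarith [sq_nonneg z.1, sq_nonneg z.2]
  nlinarith [sq_nonneg z.1, sq_nonneg z.2]

end Coordinates

/-! ### Gaussians -/

section Gaussians

/-- The exponent `A s² + B s - w²/2 + D w + C` in the coordinates `s = centerCoord z` and
`w = relCoord z`. The coefficient of `w²` is that of the ground state of the oscillator, and it is
fixed by the evolution. -/
def gaussianExponent (A B C D : ℂ) (z : ℝ × ℝ) : ℂ :=
  A * (centerCoord z : ℂ) ^ 2 + B * (centerCoord z : ℂ)
    - (1 / 2) * (relCoord z : ℂ) ^ 2 + D * (relCoord z : ℂ) + C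

theorem hasTemperateGrowth_gaussianExponent (A B C D : ℂ) :
    (gaussianExponent A B C D).HasTemperateGrowth := by
  have h1 : (fun z : ℝ × ℝ => (centerCoord z : ℂ)).HasTemperateGrowth :=
    (Complex.ofRealCLM.comp centerCoord).hasTemperateGrowth
  have h2 : (fun z : ℝ × ℝ => (relCoord z : ℂ)).HasTemperateGrowth :=
    (Complex.ofRealCLM.comp relCoord).hasTemperateGrowth
  unfold gaussianExponent
  fun_prop

theorem linear_le_quadratic {δ M x y : ℝ} (hδ : 0 < δ) (hy : y ≤ M * |x|) :
    y ≤ δ * x ^ 2 + M ^ 2 / (4 * δ) := by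
  have : 0 ≤ (2 * δ * |x| - M) ^ 2 / (4 * δ) := by positivity
  have h2 : (2 * δ * |x| - M) ^ 2 / (4 * δ) = δ * x ^ 2 + M ^ 2 / (4 * δ) - M * |x| := by
    field_simp
    rw [← sq_abs x]
    ring
  linarith

theorem gaussianExponent_re_le {A B C D : ℂ} {ε M : ℝ} (hε : 0 < ε) (hε2 : ε ≤ 1 / 2)
    (hA : A.re ≤ -ε) (hB : ‖B‖ ≤ M) (hC : ‖C‖ ≤ M) (hD : ‖D‖ ≤ M) (z : ℝ × ℝ) :
    (gaussianExponent A B C D z).re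
      ≤ (M ^ 2 / ε + M) - ε / 2 * (centerCoord z ^ 2 + relCoord z ^ 2) := by
  have hM : ∀ E : ℂ, ‖E‖ ≤ M → ∀ x : ℝ, E.re * x ≤ ε / 2 * x ^ 2 + M ^ 2 / (4 * (ε / 2)) := by
    intro E hE x
    refine linear_le_quadratic (by positivity) ?_
    refine (le_abs_self _).trans ?_
    rw [abs_mul]
    exact mul_le_mul_of_nonneg_right ((Complex.abs_re_le_norm E).trans hE) (abs_nonneg x)
  have h1 := hM B hB (centerCoord z)
  have h2 := hM D hD (relCoord z)
  have h3 := (Complex.re_le_norm C).trans hC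
  have h4 : M ^ 2 / (4 * (ε / 2)) = M ^ 2 / ε / 2 := by field_simp; norm_num
  have h5 : (gaussianExponent A B C D z).re = A.re * centerCoord z ^ 2 + B.re * centerCoord z
      - 1 / 2 * relCoord z ^ 2 + D.re * relCoord z + C.re := by
    simp only [gaussianExponent]
    norm_cast
    simp only [Complex.add_re, Complex.sub_re, Complex.re_mul_ofReal]
    norm_num [← Complex.ofReal_pow]
  rw [h4] at h1 h2
  rw [h5]
  nlinarith [sq_nonneg (centerCoord z), sq_nonneg (relCoord z),
    mul_le_mul_of_nonneg_right hA (sq_nonneg (centerCoord z)),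
    mul_le_mul_of_nonneg_right hε2 (sq_nonneg (relCoord z))]

theorem exists_gaussianExponent_re_le (A B C D : ℂ) (hA : A.re < 0) :
    ∃ K ε : ℝ, 0 < ε ∧ ∀ z, (gaussianExponent A B C D z).re ≤ K - ε * ‖z‖ ^ 2 := by
  have hε : 0 < min (-A.re) (1 / 2) := lt_min (by linarith) (by norm_num)
  have hle := gaussianExponent_re_le (A := A) (B := B) (C := C) (D := D) (M := ‖B‖ + ‖C‖ + ‖D‖) hε
    (min_le_right _ _) (by linarith [min_le_left (-A.re) (1 / 2)])
    (by linarith [norm_nonneg C, norm_nonneg D]) (by linarith [norm_nonneg B, norm_nonneg D])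
    (by linarith [norm_nonneg B, norm_nonneg C])
  exact ⟨_, _, half_pos hε, fun z => (hle z).trans
    (sub_le_sub_left (mul_le_mul_of_nonneg_left (norm_sq_le_coords z) (half_pos hε).le) _)⟩

/-- The Gaussian `exp (A s² + B s - w²/2 + D w + C)`, a Schwartz function as `Re A < 0`. -/
def gaussian (A B C D : ℂ) (hA : A.re < 0) : 𝓢(ℝ × ℝ, ℂ) :=
  schwartzExp (gaussianExponent A B C D) (hasTemperateGrowth_gaussianExponent A B C D)
    (exists_gaussianExponent_re_le A B C D hA).choose_spec.choose_spec.1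
    (exists_gaussianExponent_re_le A B C D hA).choose_spec.choose_spec.2

theorem gaussian_apply (A B C D : ℂ) (hA : A.re < 0) (z : ℝ × ℝ) :
    gaussian A B C D hA z = Complex.exp (gaussianExponent A B C D z) := rfl

end Gaussians

/-! ### The Hamiltonian on Gaussians -/

section Hamiltonian

theorem lineDerivOp_eq_of_hasDerivAt {f : 𝓢(ℝ × ℝ, ℂ)} {v z : ℝ × ℝ} {d : ℂ}
    (h : HasDerivAt (fun t : ℝ => f (z + t • v)) d 0) : (∂_{v} f) z = d := by
  rw [SchwartzMap.lineDerivOp_apply]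
  exact HasLineDerivAt.lineDeriv h

theorem hasDerivAt_coord (L : (ℝ × ℝ) →L[ℝ] ℝ) (z v : ℝ × ℝ) :
    HasDerivAt (fun t : ℝ => ((L (z + t • v) : ℝ) : ℂ)) (L v : ℂ) 0 := by
  have : HasDerivAt (fun t : ℝ => L (z + t • v)) (L v) 0 := by
    simp only [map_add, map_smul, smul_eq_mul]
    simpa using ((hasDerivAt_id (0 : ℝ)).mul_const (L v)).const_add (L z)
  exact this.ofReal_comp

theorem hasDerivAt_gaussian (A B C D : ℂ) (hA : A.re < 0) (z v : ℝ × ℝ) :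
    HasDerivAt (fun t : ℝ => gaussian A B C D hA (z + t • v))
      (((centerCoord v : ℂ) * (2 * A * centerCoord z + B)
        + (relCoord v : ℂ) * (-(relCoord z : ℂ) + D)) * gaussian A B C D hA z) 0 := by
  have h1 := hasDerivAt_coord centerCoord z v
  have h2 := hasDerivAt_coord relCoord z v
  have h3 := (((((h1.pow 2).const_mul A).add (h1.const_mul B)).sub
    ((h2.pow 2).const_mul (1 / 2))).add (h2.const_mul D)).add_const C
  refine (h3.cexp).congr_deriv ?_
  simp only [zero_smul, add_zero, gaussian_apply, gaussianExponent]
  push_cast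
  simp
  ring

theorem lineDerivOp_gaussian (A B C D : ℂ) (hA : A.re < 0) (z v : ℝ × ℝ) :
    (∂_{v} (gaussian A B C D hA)) z = ((centerCoord v : ℂ) * (2 * A * centerCoord z + B)
        + (relCoord v : ℂ) * (-(relCoord z : ℂ) + D)) * gaussian A B C D hA z :=
  lineDerivOp_eq_of_hasDerivAt (hasDerivAt_gaussian A B C D hA z v)

theorem lineDerivOp_lineDerivOp_gaussian (A B C D : ℂ) (hA : A.re < 0) (z v : ℝ × ℝ) :
    (∂_{v} (∂_{v} (gaussian A B C D hA))) z = (((centerCoord v : ℂ) * (2 * A * centerCoord z + B)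
        + (relCoord v : ℂ) * (-(relCoord z : ℂ) + D)) ^ 2
        + (2 * A * (centerCoord v : ℂ) ^ 2 - (relCoord v : ℂ) ^ 2))
        * gaussian A B C D hA z := by
  refine lineDerivOp_eq_of_hasDerivAt ?_
  simp only [lineDerivOp_gaussian]
  have h1 := hasDerivAt_coord centerCoord z v
  have h2 := hasDerivAt_coord relCoord z v
  have h3 := ((((h1.const_mul (2 * A)).add_const B).const_mul (centerCoord v : ℂ)).add
    ((h2.neg.add_const D).const_mul (relCoord v : ℂ))).mul (hasDerivAt_gaussian A B C D hA z v)
  refine h3.congr_deriv ?_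
  simp
  ring

/-- `H` as a differential operator: `p_j² = -∂_j²`. -/
theorem hamiltonian_apply (f : 𝓢(ℝ × ℝ, ℂ)) (z : ℝ × ℝ) :
    hamiltonian f z = -(1 / 2) * (∂_{((1, 0) : ℝ × ℝ)} (∂_{((1, 0) : ℝ × ℝ)} f)) z
      - (1 / 2) * (∂_{((0, 1) : ℝ × ℝ)} (∂_{((0, 1) : ℝ × ℝ)} f)) z
      + (1 / 2) * ((z.2 : ℂ) - z.1) ^ 2 * f z := by
  have hsub : ∀ g : 𝓢(ℝ × ℝ, ℂ), (positionTwo - positionOne) g z = ((z.2 : ℂ) - z.1) * g z := by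
    intro g
    rw [sub_apply, sub_apply, positionOne_apply, positionTwo_apply,
      sub_mul]
  have hmm : ∀ (v : ℝ × ℝ) (g : 𝓢(ℝ × ℝ, ℂ)),
      (-Complex.I) • ∂_{v} ((-Complex.I) • ∂_{v} g) = -(∂_{v} (∂_{v} g)) := by
    intro v g
    rw [LineDeriv.lineDerivOp_smul, smul_smul]
    simp
  simp only [hamiltonian, momentumOne, momentumTwo, hmm, add_apply,
    smul_apply, neg_apply, hsub, smul_eq_mul]
  ring

/-- In the coordinates `s`, `w` the Hamiltonian is `√2 (-∂_s²/2 + (-∂_w² + w²)/2)`. On a Gaussian the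
`w²` terms cancel, so that `H` multiplies it by a polynomial of the same shape as its exponent. -/
theorem hamiltonian_gaussian (A B C D : ℂ) (hA : A.re < 0) (z : ℝ × ℝ) :
    hamiltonian (gaussian A B C D hA) z = -(Real.sqrt 2 : ℂ) / 2 * (4 * A ^ 2 * centerCoord z ^ 2
      + 4 * A * B * centerCoord z + B ^ 2 + D ^ 2 - 2 * D * relCoord z + 2 * A - 1)
      * gaussian A B C D hA z := by
  rw [hamiltonian_apply, lineDerivOp_lineDerivOp_gaussian, lineDerivOp_lineDerivOp_gaussian]
  have hc : (((2 : ℝ) ^ (1 / 4 : ℝ) : ℝ) : ℂ) ^ 2 = (Real.sqrt 2 : ℂ) := by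
    rw [← Complex.ofReal_pow, fourthRoot_sq]
  have hs : (Real.sqrt 2 : ℂ) ^ 2 = 2 := by
    rw [← Complex.ofReal_pow, Real.sq_sqrt (by norm_num)]; norm_num
  have hc0 : (((2 : ℝ) ^ (1 / 4 : ℝ) : ℝ) : ℂ) ≠ 0 := by exact_mod_cast fourthRoot_pos.ne'
  have e1 : (centerCoord (1, 0) : ℂ) = (((2 : ℝ) ^ (1 / 4 : ℝ) : ℝ) : ℂ)⁻¹ := by
    rw [centerCoord_apply]; simp
  have e2 : (centerCoord (0, 1) : ℂ) = (((2 : ℝ) ^ (1 / 4 : ℝ) : ℝ) : ℂ)⁻¹ := by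
    rw [centerCoord_apply]; simp
  have e3 : (relCoord (1, 0) : ℂ) = (((2 : ℝ) ^ (1 / 4 : ℝ) : ℝ) : ℂ)⁻¹ := by
    rw [relCoord_apply]; simp
  have e4 : (relCoord (0, 1) : ℂ) = -(((2 : ℝ) ^ (1 / 4 : ℝ) : ℝ) : ℂ)⁻¹ := by
    rw [relCoord_apply]; simp [neg_div]
  have e5 : ((z.2 : ℂ) - z.1) = -(((2 : ℝ) ^ (1 / 4 : ℝ) : ℝ) : ℂ) * relCoord z := by
    rw [relCoord_apply, Complex.ofReal_div]
    field_simp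
    push_cast; ring
  have hinv : (((2 : ℝ) ^ (1 / 4 : ℝ) : ℝ) : ℂ)⁻¹ ^ 2 = (Real.sqrt 2 : ℂ) / 2 := by
    rw [inv_pow, hc]
    have : (Real.sqrt 2 : ℂ) ≠ 0 := fun h => by rw [h] at hs; norm_num at hs
    field_simp
    exact hs.symm
  rw [e1, e2, e3, e4, e5]
  linear_combination (-((2 * A * centerCoord z + B) ^ 2 + (-(relCoord z : ℂ) + D) ^ 2 + 2 * A - 1)
    * gaussian A B C D hA z) * hinv + (1 / 2) * (relCoord z : ℂ) ^ 2 * gaussian A B C D hA z * hc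

end Hamiltonian

/-! ### Symmetry of the Hamiltonian -/

section Symmetry

/-- The inclusion of the Schwartz space in `L²(ℝ²)`, as a linear map. -/
def schwartzToL2 : 𝓢(ℝ × ℝ, ℂ) →ₗ[ℂ] TwoModeSpace :=
  (toLpCLM ℂ ℂ 2 (volume : Measure (ℝ × ℝ))).toLinearMap

theorem schwartzToL2_apply (f : 𝓢(ℝ × ℝ, ℂ)) : schwartzToL2 f = f.toLp 2 volume := rfl

theorem inner_lineDerivOp_left (f g : 𝓢(ℝ × ℝ, ℂ)) (v : ℝ × ℝ) :
    ⟪schwartzToL2 (∂_{v} f), schwartzToL2 g⟫_ℂ = -⟪schwartzToL2 f, schwartzToL2 (∂_{v} g)⟫_ℂ := by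
  have h := integral_bilinear_lineDerivOp_right_eq_neg_left (μ := (volume : Measure (ℝ × ℝ))) f g
    ((ContinuousLinearMap.mul ℝ ℂ).comp (Complex.conjCLE : ℂ →L[ℝ] ℂ)) v
  simp only [schwartzToL2_apply, SchwartzMap.inner_toL2_toL2_eq, RCLike.inner_apply]
  simp only [ContinuousLinearMap.comp_apply, ContinuousLinearMap.mul_apply',
    ContinuousLinearEquiv.coe_coe, Complex.conjCLE_apply] at h
  simp only [mul_comm _ (conj _)]
  rw [h, neg_neg]

theorem inner_hamiltonian_left (f g : 𝓢(ℝ × ℝ, ℂ)) :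
    ⟪schwartzToL2 (hamiltonian f), schwartzToL2 g⟫_ℂ
      = ⟪schwartzToL2 f, schwartzToL2 (hamiltonian g)⟫_ℂ := by
  have hP : ∀ (v : ℝ × ℝ) (f g : 𝓢(ℝ × ℝ, ℂ)),
      ⟪schwartzToL2 ((-Complex.I) • ∂_{v} f), schwartzToL2 g⟫_ℂ
        = ⟪schwartzToL2 f, schwartzToL2 ((-Complex.I) • ∂_{v} g)⟫_ℂ := by
    intro v f g
    rw [map_smul, map_smul, inner_smul_left, inner_smul_right, inner_lineDerivOp_left]
    simp
  have hQ : ∀ f g : 𝓢(ℝ × ℝ, ℂ),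
      ⟪schwartzToL2 ((positionTwo - positionOne) f), schwartzToL2 g⟫_ℂ
        = ⟪schwartzToL2 f, schwartzToL2 ((positionTwo - positionOne) g)⟫_ℂ := by
    intro f g
    simp only [schwartzToL2_apply, SchwartzMap.inner_toL2_toL2_eq]
    refine integral_congr_ae (Filter.Eventually.of_forall fun z => ?_)
    simp only [sub_apply, positionOne_apply, positionTwo_apply, RCLike.inner_apply, map_sub,
      map_mul, Complex.conj_ofReal]
    ring
  have hhalf : (starRingEnd ℂ) (1 / 2 : ℂ) = 1 / 2 := by
    rw [map_div₀, map_one, map_ofNat]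
  simp only [hamiltonian, momentumOne, momentumTwo, map_add, inner_add_left, inner_add_right]
  simp only [map_smul schwartzToL2 (1 / 2 : ℂ), inner_smul_left, inner_smul_right, hP, hQ, hhalf]

/-- The operator `-iH` on Schwartz functions. -/
def schrodingerOperator (f : 𝓢(ℝ × ℝ, ℂ)) : 𝓢(ℝ × ℝ, ℂ) := (-Complex.I) • hamiltonian f

theorem inner_schrodingerOperator_left (f g : 𝓢(ℝ × ℝ, ℂ)) :
    ⟪schwartzToL2 (schrodingerOperator f), schwartzToL2 g⟫_ℂ
      = -⟪schwartzToL2 f, schwartzToL2 (schrodingerOperator g)⟫_ℂ := by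
  simp only [schrodingerOperator, map_smul, inner_smul_left, inner_smul_right,
    inner_hamiltonian_left]
  simp

theorem isSchrodingerGroup_iff (U : ℝ → (TwoModeSpace →L[ℂ] TwoModeSpace)) :
    IsSchrodingerGroup U ↔ HasGenerator schwartzToL2 schrodingerOperator U :=
  ⟨fun h => ⟨h.unitary, h.map_zero, h.map_add, h.strongly_continuous, h.generator⟩,
    fun h => ⟨h.unitary, h.map_zero, h.map_add, h.strongly_continuous, h.generator⟩⟩

end Symmetry

/-! ### Gaussian solutions of the Schrödinger equation -/

section Paths

theorem one_add_le_mul_exp {δ r : ℝ} (hδ : 0 < δ) (hr : 0 ≤ r) :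
    1 + r ≤ (1 + 1 / δ) * Real.exp (δ * r) := by
  have h1 := Real.add_one_le_exp (δ * r)
  have h2 : 0 < 1 / δ := by positivity
  have h3 : 1 / δ * (δ * r + 1) = r + 1 / δ := by field_simp
  have h4 : 0 ≤ δ * r := by positivity
  nlinarith

theorem norm_quadratic_le {A B D : ℂ} {M : ℝ} (hM : 1 ≤ M) (hA : ‖A‖ ≤ M) (hB : ‖B‖ ≤ M)
    (hD : ‖D‖ ≤ M) (s w : ℝ) :
    ‖4 * A ^ 2 * (s : ℂ) ^ 2 + 4 * A * B * s + B ^ 2 + D ^ 2 - 2 * D * w + 2 * A - 1‖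
      ≤ 8 * M ^ 2 * (1 + (s ^ 2 + w ^ 2)) := by
  have h0 : ∀ E : ℂ, 0 ≤ ‖E‖ := norm_nonneg
  calc _ ≤ 4 * ‖A‖ ^ 2 * |s| ^ 2 + 4 * ‖A‖ * ‖B‖ * |s| + ‖B‖ ^ 2 + ‖D‖ ^ 2 + 2 * ‖D‖ * |w|
        + 2 * ‖A‖ + 1 := by
        refine (norm_sub_le _ _).trans (add_le_add ((norm_add_le _ _).trans (add_le_add
          ((norm_sub_le _ _).trans (add_le_add ((norm_add_le _ _).trans (add_le_add
          ((norm_add_le _ _).trans (add_le_add ((norm_add_le _ _).trans (add_le_add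
          ?_ ?_)) ?_)) ?_)) ?_)) ?_)) ?_) <;> simp
    _ ≤ 4 * M ^ 2 * |s| ^ 2 + 4 * M * M * |s| + M ^ 2 + M ^ 2 + 2 * M * |w| + 2 * M + 1 := by
        gcongr
    _ ≤ _ := by
        rw [← sq_abs s, ← sq_abs w]
        have hMM : M ≤ M ^ 2 := by nlinarith
        nlinarith [mul_nonneg (sq_nonneg M) (sq_nonneg (|s| - 1)),
          mul_nonneg (sq_nonneg M) (sq_nonneg (|w| - 1)),
          mul_le_mul_of_nonneg_right hMM (abs_nonneg w),
          mul_nonneg (sq_nonneg M) (sq_nonneg w), mul_nonneg (sq_nonneg M) (sq_nonneg s),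
          sq_abs w, sq_abs s]

theorem exists_uniform_bound {f : ℝ → ℂ} (hf : Continuous f) (t₀ : ℝ) :
    ∃ M, ∀ t ∈ Metric.ball t₀ 1, ‖f t‖ ≤ M := by
  obtain ⟨M, hM⟩ := (isCompact_closedBall t₀ 1).exists_bound_of_continuousOn hf.continuousOn
  exact ⟨M, fun t ht => hM t (Metric.ball_subset_closedBall ht)⟩

/-- Gaussians solve the Schrödinger equation as soon as their coefficients solve the ordinary
differential equations read off from `hamiltonian_gaussian`. -/
theorem isSolution_gaussian {A B C D : ℝ → ℂ} (hA : ∀ t, (A t).re < 0)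
    (dA : ∀ t, HasDerivAt A (2 * Complex.I * Real.sqrt 2 * A t ^ 2) t)
    (dB : ∀ t, HasDerivAt B (2 * Complex.I * Real.sqrt 2 * A t * B t) t)
    (dC : ∀ t, HasDerivAt C
      (Complex.I * Real.sqrt 2 / 2 * (B t ^ 2 + D t ^ 2 + 2 * A t - 1)) t)
    (dD : ∀ t, HasDerivAt D (-(Complex.I * Real.sqrt 2) * D t) t) :
    IsSolution schwartzToL2 schrodingerOperator
      fun t => gaussian (A t) (B t) (C t) (D t) (hA t) := by
  intro t₀
  have hcont : ∀ {f f' : ℝ → ℂ}, (∀ t, HasDerivAt f (f' t) t) → Continuous f := fun h =>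
    continuous_iff_continuousAt.2 fun t => (h t).continuousAt
  obtain ⟨t₁, -, ht₁⟩ := (isCompact_closedBall t₀ 1).exists_isMaxOn
    (Metric.nonempty_closedBall.2 zero_le_one)
    (Complex.continuous_re.comp (hcont dA)).continuousOn
  obtain ⟨MA, hMA⟩ := exists_uniform_bound (hcont dA) t₀
  obtain ⟨MB, hMB⟩ := exists_uniform_bound (hcont dB) t₀
  obtain ⟨MC, hMC⟩ := exists_uniform_bound (hcont dC) t₀
  obtain ⟨MD, hMD⟩ := exists_uniform_bound (hcont dD) t₀
  set M := 1 + |MA| + |MB| + |MC| + |MD| with hM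
  have hM1 : 1 ≤ M := by
    linarith [abs_nonneg MA, abs_nonneg MB, abs_nonneg MC, abs_nonneg MD]
  have hle : ∀ x ∈ ({MA, MB, MC, MD} : Set ℝ), x ≤ M := by
    rintro x (h | h | h | h) <;> rw [h] <;>
      linarith [le_abs_self MA, le_abs_self MB, le_abs_self MC, le_abs_self MD, abs_nonneg MA, abs_nonneg MB, abs_nonneg MC, abs_nonneg MD]
  set ε := min (-(A t₁).re) (1 / 2) with hε
  have hεpos : 0 < ε := lt_min (by linarith [hA t₁]) (by norm_num)
  have hAε : ∀ t ∈ Metric.ball t₀ 1, (A t).re ≤ -ε := fun t ht => by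
    have h1 : (A t).re ≤ (A t₁).re := ht₁ (Metric.ball_subset_closedBall ht)
    linarith [min_le_left (-(A t₁).re) (1 / 2)]
  set δ := ε / 4 with hδ
  have hδpos : 0 < δ := by positivity
  -- the dominating function `exp (K - δ (s² + w²))`
  set K := M ^ 2 / ε + M + Real.log (8 * M ^ 2 * (1 + 1 / δ)) with hK
  let q : ℝ × ℝ → ℂ := fun z => K - δ * ((centerCoord z : ℂ) ^ 2 + (relCoord z : ℂ) ^ 2)
  have hqre : ∀ z, (q z).re = K - δ * (centerCoord z ^ 2 + relCoord z ^ 2) := fun z => by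
    simp only [q]
    norm_cast
  have hq : q.HasTemperateGrowth := by
    have h1 : (fun z : ℝ × ℝ => (centerCoord z : ℂ)).HasTemperateGrowth :=
      (Complex.ofRealCLM.comp centerCoord).hasTemperateGrowth
    have h2 : (fun z : ℝ × ℝ => (relCoord z : ℂ)).HasTemperateGrowth :=
      (Complex.ofRealCLM.comp relCoord).hasTemperateGrowth
    simp only [q]
    fun_prop
  let b : 𝓢(ℝ × ℝ, ℂ) := schwartzExp q hq hδpos fun z => by
    rw [hqre]
    exact sub_le_sub_left (mul_le_mul_of_nonneg_left (norm_sq_le_coords z) hδpos.le) K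
  let f' : ℝ → ℝ × ℝ → ℂ := fun t z =>
    schrodingerOperator (gaussian (A t) (B t) (C t) (D t) (hA t)) z
  have hf' : ∀ t z, f' t z = Complex.I * Real.sqrt 2 / 2 * (4 * A t ^ 2 * centerCoord z ^ 2
      + 4 * A t * B t * centerCoord z + B t ^ 2 + D t ^ 2 - 2 * D t * relCoord z + 2 * A t - 1)
      * gaussian (A t) (B t) (C t) (D t) (hA t) z := fun t z => by
    simp only [f', schrodingerOperator, smul_apply, hamiltonian_gaussian, smul_eq_mul]
    ring
  refine hasDerivAt_toLp_of_dominated volume (f' := f') (b := b) (fun z => rfl)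
    (fun t _ z => ?_) fun t ht z => ?_
  · have h := ((((((dA t).mul_const ((centerCoord z : ℂ) ^ 2)).add
      ((dB t).mul_const (centerCoord z : ℂ))).sub_const ((1 / 2) * (relCoord z : ℂ) ^ 2)).add
      ((dD t).mul_const (relCoord z : ℂ))).add (dC t)).cexp
    refine h.congr_deriv ?_
    rw [hf']
    simp only [gaussian_apply, gaussianExponent, Pi.add_apply]
    ring
  · have hb : ‖b z‖ = Real.exp (K - δ * (centerCoord z ^ 2 + relCoord z ^ 2)) := by
      rw [← hqre]
      exact Complex.norm_exp _
    have hs2 : ‖Complex.I * (Real.sqrt 2 : ℂ) / 2‖ ≤ 1 := by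
      rw [norm_div, norm_mul, Complex.norm_I, Complex.norm_real,
        Real.norm_of_nonneg (Real.sqrt_nonneg 2), one_mul]
      have : Real.sqrt 2 ≤ 2 := by rw [Real.sqrt_le_left (by norm_num)]; norm_num
      norm_num
      linarith
    have h1 := norm_quadratic_le hM1 ((hMA t ht).trans (hle _ (by simp)))
      ((hMB t ht).trans (hle _ (by simp))) ((hMD t ht).trans (hle _ (by simp)))
      (centerCoord z) (relCoord z)
    have h2 := gaussianExponent_re_le hεpos (min_le_right _ _) (hAε t ht)
      ((hMB t ht).trans (hle _ (by simp))) ((hMC t ht).trans (hle _ (by simp)))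
      ((hMD t ht).trans (hle _ (by simp))) z
    have h3 := one_add_le_mul_exp hδpos
      (add_nonneg (sq_nonneg (centerCoord z)) (sq_nonneg (relCoord z)))
    rw [hf', norm_mul, norm_mul, hb, gaussian_apply, Complex.norm_exp]
    set r := centerCoord z ^ 2 + relCoord z ^ 2 with hr
    calc _ ≤ 1 * (8 * M ^ 2 * (1 + r)) * Real.exp (M ^ 2 / ε + M - ε / 2 * r) := by
          gcongr
      _ ≤ 1 * (8 * M ^ 2 * ((1 + 1 / δ) * Real.exp (δ * r)))
            * Real.exp (M ^ 2 / ε + M - ε / 2 * r) := by gcongr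
      _ = Real.exp (K - δ * r) := by
          rw [hK, show M ^ 2 / ε + M + Real.log (8 * M ^ 2 * (1 + 1 / δ)) - δ * r
            = Real.log (8 * M ^ 2 * (1 + 1 / δ)) + (δ * r + (M ^ 2 / ε + M - ε / 2 * r)) by
              rw [hδ]; ring, Real.exp_add, Real.exp_add,
            Real.exp_log (by positivity)]
          ring

/-- Parameters of an initial Gaussian: a (complex) variance and centre in the coordinate `s`, the
amplitude of the coherent state in the coordinate `w`, and the logarithm of a scalar factor. -/
structure GaussianParam where
  variance : ℂ
  variance_re_pos : 0 < variance.re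
  center : ℂ
  amplitude : ℂ
  logFactor : ℂ

theorem neg_inv_two_mul_re_neg {σ : ℂ} (hσ : 0 < σ.re) : (-(2 * σ)⁻¹).re < 0 := by
  rw [Complex.neg_re, neg_lt_zero, Complex.inv_re]
  have h : 0 < (2 * σ).re := by simpa using hσ
  refine div_pos h (Complex.normSq_pos.2 fun h0 => ?_)
  simp [h0] at h

/-- The Gaussian `σ^{-1/2} exp (-(s - m)²/(2σ) - w²/2 + √2 β w - β²/2 + l)` of variance `σ`, centre
`m`, amplitude `β` and logarithmic factor `l`. The principal branch of `σ^{-1/2}` is smooth on the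
half-plane `Re σ > 0`, which is invariant under the flow. -/
def GaussianParam.toSchwartz (p : GaussianParam) : 𝓢(ℝ × ℝ, ℂ) :=
  gaussian (-(2 * p.variance)⁻¹) (p.center / p.variance)
    (-p.center ^ 2 / (2 * p.variance) - Complex.log p.variance / 2 - p.amplitude ^ 2 / 2
      + p.logFactor)
    (Real.sqrt 2 * p.amplitude) (neg_inv_two_mul_re_neg p.variance_re_pos)

/-- The motion of the parameters: in `s` a free particle, whose Gaussian spreads as
`σ ↦ σ + i√2 t`; in `w` an oscillator of frequency `√2`, which rotates the amplitude. -/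
def GaussianParam.flow (t : ℝ) (p : GaussianParam) : GaussianParam where
  variance := p.variance + Complex.I * Real.sqrt 2 * t
  variance_re_pos := by
    simpa [Complex.add_re, Complex.mul_re] using p.variance_re_pos
  center := p.center
  amplitude := Complex.exp (-(Complex.I * Real.sqrt 2 * t)) * p.amplitude
  logFactor := p.logFactor - Complex.I * Real.sqrt 2 * t / 2

theorem GaussianParam.flow_zero (p : GaussianParam) : p.flow 0 = p := by
  cases p
  simp [GaussianParam.flow]

theorem GaussianParam.isSolution (p : GaussianParam) :
    IsSolution schwartzToL2 schrodingerOperator fun t => (p.flow t).toSchwartz := by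
  have hs : (Real.sqrt 2 : ℂ) ^ 2 = 2 := by
    rw [← Complex.ofReal_pow, Real.sq_sqrt (by norm_num)]; norm_num
  have hlin : ∀ (k : ℂ) (t : ℝ), HasDerivAt (fun t : ℝ => k * (t : ℂ)) k t := fun k t => by
    simpa using (hasDerivAt_id t).ofReal_comp.const_mul k
  have hσ : ∀ t : ℝ, HasDerivAt (fun t : ℝ => p.variance + Complex.I * Real.sqrt 2 * t)
      (Complex.I * Real.sqrt 2) t := fun t => (hlin _ t).const_add _
  have hne : ∀ t : ℝ, p.variance + Complex.I * Real.sqrt 2 * t ≠ 0 := fun t h0 => by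
    have h := (p.flow t).variance_re_pos
    simp [GaussianParam.flow, h0] at h
  have hslit : ∀ t : ℝ, p.variance + Complex.I * Real.sqrt 2 * t ∈ Complex.slitPlane := fun t =>
    Or.inl (p.flow t).variance_re_pos
  have hβ : ∀ t : ℝ, HasDerivAt
      (fun t : ℝ => Complex.exp (-(Complex.I * Real.sqrt 2 * t)) * p.amplitude)
      (-(Complex.I * Real.sqrt 2)
        * (Complex.exp (-(Complex.I * Real.sqrt 2 * t)) * p.amplitude)) t := fun t => by
    refine ((hlin _ t).neg.cexp.mul_const p.amplitude).congr_deriv ?_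
    simp only [Pi.neg_apply]
    ring
  refine isSolution_gaussian (fun t => neg_inv_two_mul_re_neg (p.flow t).variance_re_pos)
    (fun t => ?_) (fun t => ?_) (fun t => ?_) fun t => ?_
  · refine (((hσ t).const_mul 2).inv (mul_ne_zero two_ne_zero (hne t))).neg.congr_deriv ?_
    have := hne t
    simp only [GaussianParam.flow]
    field_simp
  · refine ((hasDerivAt_const t p.center).div (hσ t) (hne t)).congr_deriv ?_
    have := hne t
    simp only [GaussianParam.flow]
    field_simp
    ring
  · refine (((((hasDerivAt_const t (-p.center ^ 2)).div ((hσ t).const_mul 2)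
      (mul_ne_zero two_ne_zero (hne t))).sub (((hσ t).clog_real (hslit t)).div_const 2)).sub
      (((hβ t).pow 2).div_const 2)).add
      (((hlin (Complex.I * Real.sqrt 2) t).div_const 2).const_sub p.logFactor)).congr_deriv ?_
    have := hne t
    simp only [GaussianParam.flow, mul_pow, hs]
    generalize Complex.exp (-(Complex.I * Real.sqrt 2 * t)) = e
    field_simp
    ring
  · refine ((hβ t).const_mul (Real.sqrt 2 : ℂ)).congr_deriv ?_
    simp only [GaussianParam.flow]
    ring

end Paths

/-! ### The states `ψ_{αβ}` as Gaussians -/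

section States

theorem inner_schwartzToL2_left (g : 𝓢(ℝ × ℝ, ℂ)) (f : TwoModeSpace) :
    Integrable (fun z => f z * conj (g z)) ∧
      ⟪schwartzToL2 g, f⟫_ℂ = ∫ z, f z * conj (g z) := by
  have hae : (fun z => ⟪(schwartzToL2 g : TwoModeSpace) z, f z⟫_ℂ)
      =ᵐ[volume] fun z => f z * conj (g z) := by
    filter_upwards [g.coeFn_toLp 2 volume] with z hz
    rw [schwartzToL2_apply, hz, RCLike.inner_apply]
  exact ⟨(L2.integrable_inner (𝕜 := ℂ) (schwartzToL2 g) f).congr hae, integral_congr_ae hae⟩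

/-- The logarithm of the factor of `ψ_{αβ}` that makes it a unit vector, without the holomorphic part
`-α²/2 - β²/2`. -/
def coherentLogFactor (α β : ℂ) : ℂ :=
  Real.log ((2 : ℝ) ^ (1 / 4 : ℝ) * Real.pi ^ (-(1 / 4) : ℝ) * Real.pi ^ (-(1 / 4) : ℝ))
    - (‖α‖ : ℂ) ^ 2 / 2 - (‖β‖ : ℂ) ^ 2 / 2

theorem twoModeFun_eq (α β : ℂ) (z : ℝ × ℝ) :
    twoModeFun α β z = Complex.exp (gaussianExponent (-(1 / 2)) (Real.sqrt 2 * α)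
      (coherentLogFactor α β - α ^ 2 / 2 - β ^ 2 / 2) (Real.sqrt 2 * β) z) := by
  have hlog : Complex.exp (Real.log ((2 : ℝ) ^ (1 / 4 : ℝ) * Real.pi ^ (-(1 / 4) : ℝ)
      * Real.pi ^ (-(1 / 4) : ℝ)))
      = (((2 : ℝ) ^ (1 / 4 : ℝ) : ℝ) : ℂ) * ((Real.pi ^ (-(1 / 4) : ℝ) : ℝ) : ℂ)
        * ((Real.pi ^ (-(1 / 4) : ℝ) : ℝ) : ℂ) := by
    rw [← Complex.ofReal_exp, Real.exp_log (by positivity)]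
    push_cast
    rfl
  rw [twoModeFun, coherent, coherent, ← centerCoord_apply, ← relCoord_apply]
  rw [show gaussianExponent (-(1 / 2)) (Real.sqrt 2 * α)
      (coherentLogFactor α β - α ^ 2 / 2 - β ^ 2 / 2) (Real.sqrt 2 * β) z
    = (Real.log ((2 : ℝ) ^ (1 / 4 : ℝ) * Real.pi ^ (-(1 / 4) : ℝ) * Real.pi ^ (-(1 / 4) : ℝ)) : ℂ)
      + (-((‖α‖ : ℂ) ^ 2) / 2
        + -((centerCoord z : ℂ) ^ 2 - 2 * (Real.sqrt 2 : ℂ) * α * centerCoord z + α ^ 2) / 2)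
      + (-((‖β‖ : ℂ) ^ 2) / 2
        + -((relCoord z : ℂ) ^ 2 - 2 * (Real.sqrt 2 : ℂ) * β * relCoord z + β ^ 2) / 2) by
    rw [gaussianExponent, coherentLogFactor]; ring]
  rw [Complex.exp_add, Complex.exp_add, Complex.exp_add, Complex.exp_add, hlog]
  ring

theorem neg_half_re_neg : (-(1 / 2) : ℂ).re < 0 := by norm_num

theorem twoModeState_eq (α β : ℂ) :
    twoModeState α β = schwartzToL2 (gaussian (-(1 / 2)) (Real.sqrt 2 * α)
      (coherentLogFactor α β - α ^ 2 / 2 - β ^ 2 / 2) (Real.sqrt 2 * β) neg_half_re_neg) :=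
  MemLp.toLp_congr (memLp_twoModeFun α β) (SchwartzMap.memLp _ 2 volume)
    (Filter.Eventually.of_forall fun z => twoModeFun_eq α β z)

/-- `ψ_{αβ}` as a member of the family of Gaussians: its variance is `1` and its centre `√2 α`. -/
def coherentParam (α β : ℂ) : GaussianParam where
  variance := 1
  variance_re_pos := by simp
  center := Real.sqrt 2 * α
  amplitude := β
  logFactor := coherentLogFactor α β + α ^ 2 / 2

theorem twoModeState_eq_toSchwartz (α β : ℂ) :
    twoModeState α β = schwartzToL2 (coherentParam α β).toSchwartz := by
  have hs : (Real.sqrt 2 : ℂ) ^ 2 = 2 := by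
    rw [← Complex.ofReal_pow, Real.sq_sqrt (by norm_num)]; norm_num
  rw [twoModeState_eq]
  congr 1
  ext z
  simp only [GaussianParam.toSchwartz, coherentParam, gaussian_apply, gaussianExponent,
    Complex.log_one, mul_pow, hs]
  congr 1
  ring

end States

/-! ### The Gram kernel of the states -/

section Gram

theorem integral_cexp_plane {p : ℝ} (hp : 0 < p) (b d e : ℂ) :
    Integrable (fun z : ℝ × ℝ => Complex.exp (-(p : ℂ) * ((z.1 : ℂ) ^ 2 + (z.2 : ℂ) ^ 2)
      + b * z.1 + d * z.2 + e)) ∧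
    ∫ z : ℝ × ℝ, Complex.exp (-(p : ℂ) * ((z.1 : ℂ) ^ 2 + (z.2 : ℂ) ^ 2) + b * z.1 + d * z.2 + e)
      = Real.pi / p * Complex.exp ((b ^ 2 + d ^ 2) / (4 * p) + e) := by
  have hre : (-(p : ℂ)).re < 0 := by simpa using hp
  have hre' : 0 < (p : ℂ).re := by simpa using hp
  have hsplit : ∀ z : ℝ × ℝ,
      Complex.exp (-(p : ℂ) * ((z.1 : ℂ) ^ 2 + (z.2 : ℂ) ^ 2) + b * z.1 + d * z.2 + e)
      = Complex.exp (-(p : ℂ) * (z.1 : ℂ) ^ 2 + b * z.1 + 0)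
        * Complex.exp (-(p : ℂ) * (z.2 : ℂ) ^ 2 + d * z.2 + e) := by
    intro z
    rw [← Complex.exp_add]
    congr 1
    ring
  simp only [hsplit]
  refine ⟨(integrable_cexp_quadratic hre' b 0).mul_prod (integrable_cexp_quadratic hre' d e), ?_⟩
  rw [Measure.volume_eq_prod, integral_prod_mul (fun x : ℝ => Complex.exp
    (-(p : ℂ) * (x : ℂ) ^ 2 + b * x + 0)) fun x : ℝ => Complex.exp
    (-(p : ℂ) * (x : ℂ) ^ 2 + d * x + e), integral_cexp_quadratic hre, integral_cexp_quadratic hre]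
  have hp0 : (p : ℂ) ≠ 0 := by exact_mod_cast hp.ne'
  have hpi : ((Real.pi : ℂ) / - -(p : ℂ)) ^ (1 / 2 : ℂ) * ((Real.pi : ℂ) / - -(p : ℂ)) ^ (1 / 2 : ℂ)
      = Real.pi / p := by
    rw [← Complex.cpow_add _ _ (by simp [Real.pi_ne_zero, hp0])]
    norm_num
  rw [mul_mul_mul_comm, hpi, ← Complex.exp_add]
  congr 2
  field_simp
  ring

/-- The overlap `⟪ξ_γ, ξ_α⟫ = exp (-|γ|²/2 - |α|²/2 + conj γ α)` of one-mode coherent states. -/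
def coherentKernel (γ α : ℂ) : ℂ :=
  Complex.exp (-(‖γ‖ : ℂ) ^ 2 / 2 - (‖α‖ : ℂ) ^ 2 / 2 + conj γ * α)

theorem coherentKernel_self (α : ℂ) : coherentKernel α α = 1 := by
  rw [coherentKernel, Complex.conj_mul', ← Complex.exp_zero]
  congr 1
  ring

theorem inner_twoModeState (γ δ α β : ℂ) :
    ⟪twoModeState γ δ, twoModeState α β⟫_ℂ = coherentKernel γ α * coherentKernel δ β := by
  set c : ℝ := (2 : ℝ) ^ (1 / 4 : ℝ) with hc
  have hs : (Real.sqrt 2 : ℂ) ^ 2 = 2 := by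
    rw [← Complex.ofReal_pow, Real.sq_sqrt (by norm_num)]; norm_num
  have hc2 : (c : ℂ) ^ 2 = (Real.sqrt 2 : ℂ) := by rw [← Complex.ofReal_pow, fourthRoot_sq]
  have hc0 : (c : ℂ) ≠ 0 := by exact_mod_cast fourthRoot_pos.ne'
  have hs0 : (Real.sqrt 2 : ℂ) ≠ 0 := fun h => by rw [h] at hs; norm_num at hs
  set N : ℝ := Real.log (c * Real.pi ^ (-(1 / 4) : ℝ) * Real.pi ^ (-(1 / 4) : ℝ)) with hN
  have hnorm : Complex.exp (2 * N) = Real.sqrt 2 / Real.pi := by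
    rw [two_mul, Complex.exp_add, ← Complex.ofReal_exp, hN, Real.exp_log (by positivity)]
    have hpi : (Real.pi ^ (-(1 / 4) : ℝ)) ^ 4 = Real.pi⁻¹ := by
      rw [← Real.rpow_natCast, ← Real.rpow_mul Real.pi_pos.le, ← Real.rpow_neg_one]
      norm_num
    rw [← Complex.ofReal_mul, ← Complex.ofReal_div, div_eq_mul_inv (Real.sqrt 2), ← hpi, ← fourthRoot_sq]
    congr 1
    ring
  rw [twoModeState_eq γ δ, twoModeState_eq α β]
  simp only [schwartzToL2_apply, SchwartzMap.inner_toL2_toL2_eq]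
  have hint := (integral_cexp_plane (p := Real.sqrt 2) (by positivity)
    (Real.sqrt 2 * ((conj γ + α) + (conj δ + β)) / c)
    (Real.sqrt 2 * ((conj γ + α) - (conj δ + β)) / c)
    (2 * N - (‖γ‖ : ℂ) ^ 2 / 2 - (‖α‖ : ℂ) ^ 2 / 2 - (‖δ‖ : ℂ) ^ 2 / 2 - (‖β‖ : ℂ) ^ 2 / 2
      - (conj γ ^ 2 + α ^ 2 + conj δ ^ 2 + β ^ 2) / 2)).2
  calc _ = _ := by
        refine (integral_congr_ae (Filter.Eventually.of_forall fun z => ?_)).trans hint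
        simp only [RCLike.inner_apply, gaussian_apply]
        rw [← Complex.exp_conj, ← Complex.exp_add]
        congr 1
        have hsw : (centerCoord z : ℂ) ^ 2 + (relCoord z : ℂ) ^ 2
            = Real.sqrt 2 * ((z.1 : ℂ) ^ 2 + (z.2 : ℂ) ^ 2) := by
          exact_mod_cast centerCoord_sq_add_relCoord_sq z
        have h1 : (centerCoord z : ℂ) = ((z.1 : ℂ) + z.2) / c := by
          rw [centerCoord_apply]; push_cast; rfl
        have h2 : (relCoord z : ℂ) = ((z.1 : ℂ) - z.2) / c := by
          rw [relCoord_apply]; push_cast; rfl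
        simp only [gaussianExponent, coherentLogFactor, map_add, map_sub, map_mul, map_neg,
          map_div₀, map_pow, map_one, map_ofNat, Complex.conj_ofReal, ← hc, ← hN]
        rw [neg_mul (Real.sqrt 2 : ℂ), ← hsw, h1, h2]
        ring
    _ = Real.pi / Real.sqrt 2 * (Real.sqrt 2 / Real.pi)
          * (coherentKernel γ α * coherentKernel δ β) := by
        rw [← hnorm, coherentKernel, coherentKernel, mul_assoc, ← Complex.exp_add,
          ← Complex.exp_add]
        congr 2
        rw [div_pow, div_pow, hc2, mul_pow, mul_pow, hs]
        field_simp
        rw [hs]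
        ring
    _ = _ := by
        have : (Real.pi : ℂ) ≠ 0 := by exact_mod_cast Real.pi_ne_zero
        field_simp

theorem integral_coherentKernel (γ δ : ℂ) :
    Integrable (fun α => coherentKernel γ α * coherentKernel α δ) ∧
      ∫ α, coherentKernel γ α * coherentKernel α δ = Real.pi * coherentKernel γ δ := by
  obtain ⟨h1, h2⟩ := integral_cexp_plane one_pos (conj γ + δ) (Complex.I * (conj γ - δ))
    (-(‖γ‖ : ℂ) ^ 2 / 2 - (‖δ‖ : ℂ) ^ 2 / 2)
  have heq : ∀ α : ℂ, coherentKernel γ α * coherentKernel α δ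
      = (fun z : ℝ × ℝ => Complex.exp (-((1 : ℝ) : ℂ) * ((z.1 : ℂ) ^ 2 + (z.2 : ℂ) ^ 2)
        + (conj γ + δ) * z.1 + (Complex.I * (conj γ - δ)) * z.2
        + (-(‖γ‖ : ℂ) ^ 2 / 2 - (‖δ‖ : ℂ) ^ 2 / 2))) (Complex.measurableEquivRealProd α) := by
    intro α
    simp only [coherentKernel, Complex.measurableEquivRealProd_apply]
    rw [← Complex.exp_add]
    congr 1
    have h3 : (‖α‖ : ℂ) ^ 2 = (α.re : ℂ) ^ 2 + (α.im : ℂ) ^ 2 := by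
      rw [← Complex.ofReal_pow, Complex.sq_norm, Complex.normSq_apply]
      push_cast
      ring
    have h4 : conj α = α.re - α.im * Complex.I := by
      apply Complex.ext <;> simp
    rw [h4, h3, Complex.ofReal_one]
    linear_combination -(conj γ) * Complex.re_add_im α
  have hmp := Complex.volume_preserving_equiv_real_prod
  constructor
  · rw [show (fun α => coherentKernel γ α * coherentKernel α δ) = _ from funext heq]
    exact (hmp.integrable_comp_emb Complex.measurableEquivRealProd.measurableEmbedding).2 h1
  · rw [show (fun α => coherentKernel γ α * coherentKernel α δ) = _ from funext heq,
      hmp.integral_comp Complex.measurableEquivRealProd.measurableEmbedding (fun z : ℝ × ℝ =>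
        Complex.exp (-((1 : ℝ) : ℂ) * ((z.1 : ℂ) ^ 2 + (z.2 : ℂ) ^ 2)
        + (conj γ + δ) * z.1 + (Complex.I * (conj γ - δ)) * z.2
        + (-(‖γ‖ : ℂ) ^ 2 / 2 - (‖δ‖ : ℂ) ^ 2 / 2))), h2, coherentKernel]
    congr 1
    · simp
    · congr 1
      push_cast
      linear_combination ((conj γ - δ) ^ 2 / 4) * Complex.I_sq

theorem stronglyMeasurable_inner_twoModeState (f : TwoModeSpace) :
    StronglyMeasurable fun p : ℂ × ℂ => ⟪twoModeState p.1 p.2, f⟫_ℂ := by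
  have h1 : ∀ p : ℂ × ℂ, ⟪twoModeState p.1 p.2, f⟫_ℂ
      = ∫ z, f z * conj (twoModeFun p.1 p.2 z) := by
    intro p
    rw [twoModeState_eq, (inner_schwartzToL2_left _ f).2]
    simp only [twoModeFun_eq, gaussian_apply]
  simp only [h1]
  have h2 : Continuous fun q : (ℂ × ℂ) × (ℝ × ℝ) => conj (twoModeFun q.1.1 q.1.2 q.2) := by
    unfold twoModeFun coherent
    fun_prop
  refine StronglyMeasurable.integral_prod_right' (f := fun q : (ℂ × ℂ) × (ℝ × ℝ) =>
    f q.2 * conj (twoModeFun q.1.1 q.1.2 q.2)) ?_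
  exact ((Lp.stronglyMeasurable f).comp_measurable measurable_snd).mul h2.stronglyMeasurable

theorem isReproducing_twoModeState (β : ℂ) :
    IsReproducing volume (fun α => twoModeState α β) Real.pi where
  measurable f := ((stronglyMeasurable_inner_twoModeState f).comp_measurable
    (measurable_prodMk_right (y := β))).aestronglyMeasurable
  integrable γ δ := by
    simp only [inner_twoModeState, coherentKernel_self, mul_one]
    exact (integral_coherentKernel γ δ).1
  integral_eq γ δ := by
    simp only [inner_twoModeState, coherentKernel_self, mul_one]
    exact (integral_coherentKernel γ δ).2

theorem isReproducing_twoModeState_prod :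
    IsReproducing volume (fun p : ℂ × ℂ => twoModeState p.1 p.2) (Real.pi ^ 2) where
  measurable f := (stronglyMeasurable_inner_twoModeState f).aestronglyMeasurable
  integrable p q := by
    simp only [inner_twoModeState, mul_mul_mul_comm]
    exact (integral_coherentKernel p.1 q.1).1.mul_prod (integral_coherentKernel p.2 q.2).1
  integral_eq p q := by
    simp only [inner_twoModeState, mul_mul_mul_comm]
    rw [Measure.volume_eq_prod, integral_prod_mul (fun α => coherentKernel p.1 α
      * coherentKernel α q.1) fun α => coherentKernel p.2 α * coherentKernel α q.2,
      (integral_coherentKernel p.1 q.1).2, (integral_coherentKernel p.2 q.2).2]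
    push_cast
    ring

end Gram

/-! ### Closed spans of the states -/

section Totality

/-- The closed span of the `ψ_{αβ}`, `α ∈ ℂ`, which is `L²(ℝ) ⊗ ξ_β` in the coordinates `s`, `w`. It is
the range of `Q_β`. -/
def coherentSpace (β : ℂ) : Submodule ℂ TwoModeSpace := closedSpan fun α => twoModeState α β

instance (β : ℂ) : CompleteSpace (coherentSpace β) :=
  inferInstanceAs (CompleteSpace (closedSpan fun α => twoModeState α β))

/-- Every Gaussian in `s`, times `ξ_β` in `w`, lies in `coherentSpace β`. For `f` orthogonal to all
`ψ_{αβ}`, the imaginary `α` say that `f` times a Gaussian, integrated over `w`, has vanishing Fourier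
transform in `s`; hence `f` is orthogonal to every function of `s` times `ξ_β`. -/
theorem gaussian_mem_coherentSpace (A B C β : ℂ) (hA : A.re < 0) :
    schwartzToL2 (gaussian A B C (Real.sqrt 2 * β) hA) ∈ coherentSpace β := by
  have hs0 : (Real.sqrt 2 : ℂ) ≠ 0 := by
    exact_mod_cast (Real.sqrt_pos.2 (by norm_num : (0 : ℝ) < 2)).ne'
  rw [← Submodule.orthogonal_orthogonal (coherentSpace β), Submodule.mem_orthogonal']
  intro f hf
  have horth : ∀ α, ⟪twoModeState α β, f⟫_ℂ = 0 := fun α =>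
    hf _ (mem_closedSpan (fun α => twoModeState α β) α)
  have hint := inner_schwartzToL2_left (gaussian A B C (Real.sqrt 2 * β) hA) f
  rw [hint.2]
  have hsplit : ∀ z, f z * conj (gaussian A B C (Real.sqrt 2 * β) hA z)
      = f z * conj (gaussian (-(1 / 2)) 0 0 (Real.sqrt 2 * β) neg_half_re_neg z)
        * (fun s : ℝ => conj (Complex.exp ((A + 1 / 2) * (s : ℂ) ^ 2 + B * s + C)))
          (centerCoord z) := by
    intro z
    rw [mul_assoc, ← map_mul, gaussian_apply, gaussian_apply, ← Complex.exp_add]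
    congr 3
    simp only [gaussianExponent]
    ring
  simp only [hsplit] at hint ⊢
  refine integral_mul_comp_eq_zero centerCoord.continuous.measurable
    (inner_schwartzToL2_left
      (gaussian (-(1 / 2)) 0 0 (Real.sqrt 2 * β) neg_half_re_neg) f).1
    (φ := fun s : ℝ => conj (Complex.exp ((A + 1 / 2) * (s : ℂ) ^ 2 + B * s + C)))
    (fun L => ?_) ?_ hint.1
  · set α : ℂ := -Complex.I * L 1 / Real.sqrt 2 with hα
    have h := horth α
    rw [twoModeState_eq, (inner_schwartzToL2_left _ f).2] at h
    have hL : ∀ s : ℝ, L s = s * L 1 := fun s => by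
      rw [← smul_eq_mul, ← map_smul, smul_eq_mul, mul_one]
    have h1 : ∀ z, f z * conj (gaussian (-(1 / 2)) (Real.sqrt 2 * α)
          (coherentLogFactor α β - α ^ 2 / 2 - β ^ 2 / 2) (Real.sqrt 2 * β) neg_half_re_neg z)
        = conj (Complex.exp (coherentLogFactor α β - α ^ 2 / 2 - β ^ 2 / 2)) *
          (f z * conj (gaussian (-(1 / 2)) 0 0 (Real.sqrt 2 * β) neg_half_re_neg z)
            * Complex.exp (L (centerCoord z) * Complex.I)) := by
      intro z
      have h2 : Complex.exp (L (centerCoord z) * Complex.I)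
          = conj (Complex.exp (Real.sqrt 2 * α * centerCoord z)) := by
        rw [← Complex.exp_conj, hL, hα]
        congr 1
        simp only [map_mul, map_div₀, map_neg, Complex.conj_I, Complex.conj_ofReal]
        push_cast
        field_simp
      rw [h2, mul_assoc, mul_left_comm, ← map_mul, ← map_mul, gaussian_apply, gaussian_apply,
        ← Complex.exp_add, ← Complex.exp_add]
      congr 3
      simp only [gaussianExponent]
      ring
    simp only [h1] at h
    rw [integral_const_mul] at h
    exact (mul_eq_zero.1 h).resolve_left ((map_ne_zero _).2 (Complex.exp_ne_zero _))
  · exact (Continuous.measurable (by fun_prop))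

/-- The `ψ_{αβ}` are total in `L²(ℝ²)`: for imaginary `α` and `β` the overlaps with `f` are the Fourier
transform of `f` times a Gaussian. -/
theorem eq_zero_of_forall_inner_twoModeState {f : TwoModeSpace}
    (hf : ∀ α β, ⟪twoModeState α β, f⟫_ℂ = 0) : f = 0 := by
  have hs0 : (Real.sqrt 2 : ℂ) ≠ 0 := by
    exact_mod_cast (Real.sqrt_pos.2 (by norm_num : (0 : ℝ) < 2)).ne'
  have hc0 : (((2 : ℝ) ^ (1 / 4 : ℝ) : ℝ) : ℂ) ≠ 0 := by exact_mod_cast fourthRoot_pos.ne'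
  set g := gaussian (-(1 / 2)) 0 0 0 neg_half_re_neg with hg
  have hint := (inner_schwartzToL2_left g f).1
  have hae : (fun z => f z * conj (g z)) =ᵐ[volume] 0 := by
    refine hint.ae_eq_zero_of_forall_setIntegral_eq_zero fun S hS _ => ?_
    have hind : ∀ z, S.indicator (fun z => f z * conj (g z)) z
        = f z * conj (g z) * S.indicator (fun _ => (1 : ℂ)) (id z) := by
      intro z
      by_cases hz : z ∈ S <;> simp [hz]
    rw [← integral_indicator hS]
    have hi := hint.indicator hS
    rw [show S.indicator (fun z => f z * conj (g z)) = _ from funext hind] at hi ⊢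
    refine integral_mul_comp_eq_zero measurable_id hint (fun L => ?_)
      (measurable_const.indicator hS) hi
    set c : ℝ := (2 : ℝ) ^ (1 / 4 : ℝ) with hc
    set α : ℂ := -Complex.I * (c / 2 * (L (1, 0) + L (0, 1)) : ℝ) / Real.sqrt 2 with hα
    set β : ℂ := -Complex.I * (c / 2 * (L (1, 0) - L (0, 1)) : ℝ) / Real.sqrt 2 with hβ
    have h := hf α β
    rw [twoModeState_eq, (inner_schwartzToL2_left _ f).2] at h
    have hL : ∀ z : ℝ × ℝ, (L z : ℂ) = centerCoord z * (c / 2 * (L (1, 0) + L (0, 1)) : ℝ)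
        + relCoord z * (c / 2 * (L (1, 0) - L (0, 1)) : ℝ) := fun z => by
      have h1 : L z = z.1 * L (1, 0) + z.2 * L (0, 1) := by
        rw [← smul_eq_mul, ← smul_eq_mul, ← map_smul, ← map_smul, ← map_add]
        simp
      rw [centerCoord_apply, relCoord_apply, h1, ← hc]
      push_cast
      field_simp
      ring
    have h1 : ∀ z, f z * conj (gaussian (-(1 / 2)) (Real.sqrt 2 * α)
          (coherentLogFactor α β - α ^ 2 / 2 - β ^ 2 / 2) (Real.sqrt 2 * β) neg_half_re_neg z)
        = conj (Complex.exp (coherentLogFactor α β - α ^ 2 / 2 - β ^ 2 / 2)) *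
          (f z * conj (g z) * Complex.exp (L (id z) * Complex.I)) := by
      intro z
      have h2 : Complex.exp (L z * Complex.I)
          = conj (Complex.exp (Real.sqrt 2 * α * centerCoord z
            + Real.sqrt 2 * β * relCoord z)) := by
        rw [← Complex.exp_conj, hL, hα, hβ]
        congr 1
        simp only [map_mul, map_add, map_div₀, map_neg, Complex.conj_I, Complex.conj_ofReal]
        field_simp
      rw [id, h2, mul_assoc, mul_left_comm, ← map_mul, ← map_mul, hg, gaussian_apply,
        gaussian_apply, ← Complex.exp_add, ← Complex.exp_add]
      congr 3
      simp only [gaussianExponent]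
      ring
    simp only [h1] at h
    rw [integral_const_mul] at h
    exact (mul_eq_zero.1 h).resolve_left ((map_ne_zero _).2 (Complex.exp_ne_zero _))
  rw [Lp.eq_zero_iff_ae_eq_zero]
  filter_upwards [hae] with z hz
  refine (mul_eq_zero.1 hz).resolve_right ((map_ne_zero _).2 ?_)
  rw [hg, gaussian_apply]
  exact Complex.exp_ne_zero _

theorem closedSpan_twoModeState_prod :
    closedSpan (fun p : ℂ × ℂ => twoModeState p.1 p.2) = ⊤ := by
  rw [← Submodule.orthogonal_eq_bot_iff, Submodule.eq_bot_iff]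
  intro f hf
  exact eq_zero_of_forall_inner_twoModeState fun α β =>
    hf _ (mem_closedSpan (fun p : ℂ × ℂ => twoModeState p.1 p.2) (α, β))

theorem dense_span_gaussianParam :
    Dense (Submodule.span ℂ (Set.range fun p : GaussianParam => schwartzToL2 p.toSchwartz)
      : Set TwoModeSpace) := by
  rw [Submodule.dense_iff_topologicalClosure_eq_top, eq_top_iff, ← closedSpan_twoModeState_prod]
  refine Submodule.topologicalClosure_mono (Submodule.span_mono ?_)
  rintro _ ⟨p, rfl⟩
  exact ⟨coherentParam p.1 p.2, (twoModeState_eq_toSchwartz p.1 p.2).symm⟩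

end Totality

/-! ### The unitary group -/

section Evolution

theorem isSchrodingerGroup_evolution : IsSchrodingerGroup evolution := by
  obtain ⟨U, hU⟩ := exists_hasGenerator inner_schrodingerOperator_left
    GaussianParam.isSolution GaussianParam.flow_zero dense_span_gaussianParam
  exact Classical.epsilon_spec ⟨U, (isSchrodingerGroup_iff U).2 hU⟩

theorem hasGenerator_evolution : HasGenerator schwartzToL2 schrodingerOperator evolution :=
  (isSchrodingerGroup_iff _).1 isSchrodingerGroup_evolution

theorem IsSchrodingerGroup.eq_evolution {U : ℝ → (TwoModeSpace →L[ℂ] TwoModeSpace)}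
    (hU : IsSchrodingerGroup U) : U = evolution :=
  ((isSchrodingerGroup_iff U).1 hU).eq_of_solutions hasGenerator_evolution
    GaussianParam.isSolution GaussianParam.flow_zero dense_span_gaussianParam

theorem evolution_apply_gaussianParam (t : ℝ) (p : GaussianParam) :
    evolution t (schwartzToL2 p.toSchwartz) = schwartzToL2 (p.flow t).toSchwartz := by
  have h := hasGenerator_evolution.apply_solution p.isSolution t
  rwa [p.flow_zero] at h

/-- The evolution maps `coherentSpace β` into `coherentSpace (e^{-i√2 t} β)`: it moves each `ψ_{αβ}` to
a spread Gaussian in `s` times a multiple of `ξ_{e^{-i√2 t} β}` in `w`. -/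
theorem evolution_mem_coherentSpace (t : ℝ) {β : ℂ} {f : TwoModeSpace}
    (hf : f ∈ coherentSpace β) :
    evolution t f ∈ coherentSpace (Complex.exp (-(Complex.I * Real.sqrt 2 * t)) * β) := by
  have h : coherentSpace β ≤ (coherentSpace (Complex.exp (-(Complex.I * Real.sqrt 2 * t)) * β)).comap
      (evolution t).toLinearMap := by
    refine Submodule.topologicalClosure_minimal _ (Submodule.span_le.2 ?_)
      ((Submodule.isClosed_topologicalClosure _).preimage (evolution t).continuous)
    rintro _ ⟨α, rfl⟩
    change evolution t (twoModeState α β)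
      ∈ coherentSpace (Complex.exp (-(Complex.I * Real.sqrt 2 * t)) * β)
    rw [twoModeState_eq_toSchwartz, evolution_apply_gaussianParam]
    exact gaussian_mem_coherentSpace _ _ _ _ _
  exact h hf

end Evolution

/-! ### The projections `Q_β` -/

section Projections

theorem isCoherentIntegral_starProjection (β : ℂ) :
    IsCoherentIntegral β (coherentSpace β).starProjection := by
  intro f g
  obtain ⟨h1, h2⟩ := (isReproducing_twoModeState β).resolution f g
  refine ⟨h1, ?_⟩
  have hpi : (Real.pi : ℂ) ≠ 0 := by exact_mod_cast Real.pi_ne_zero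
  rw [h2, ← mul_assoc, one_div, inv_mul_cancel₀ hpi, one_mul]
  rfl

theorem IsCoherentIntegral.eq {β : ℂ} {Q Q' : TwoModeSpace →L[ℂ] TwoModeSpace}
    (hQ : IsCoherentIntegral β Q) (hQ' : IsCoherentIntegral β Q') : Q = Q' :=
  ContinuousLinearMap.ext fun g => ext_inner_left ℂ fun f =>
    (hQ f g).2.trans (hQ' f g).2.symm

theorem isCoherentIntegral_projQ (β : ℂ) : IsCoherentIntegral β (projQ β) :=
  Classical.epsilon_spec ⟨_, isCoherentIntegral_starProjection β⟩

theorem projQ_eq_starProjection (β : ℂ) : projQ β = (coherentSpace β).starProjection :=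
  (isCoherentIntegral_projQ β).eq (isCoherentIntegral_starProjection β)

theorem isStarProjection_projQ (β : ℂ) : IsStarProjection (projQ β) := by
  rw [projQ_eq_starProjection]
  exact isStarProjection_starProjection

theorem evolution_mul_projQ (t : ℝ) (β : ℂ) :
    evolution t * projQ β
      = projQ (Complex.exp (-(Complex.I * Real.sqrt 2 * t)) * β) * evolution t := by
  have hU := isSchrodingerGroup_evolution
  ext1 f
  rw [mul_apply_eq_comp, mul_apply_eq_comp, projQ_eq_starProjection, projQ_eq_starProjection]
  refine (Submodule.eq_starProjection_of_mem_of_inner_eq_zero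
    (evolution_mem_coherentSpace t (Submodule.starProjection_apply_mem _ f)) fun g hg => ?_).symm
  -- `g` is the image under `U t` of `U (-t) g`, which lies in `coherentSpace β`
  have hback := evolution_mem_coherentSpace (-t) hg
  rw [← mul_assoc, ← Complex.exp_add, show -(Complex.I * Real.sqrt 2 * ((-t : ℝ) : ℂ))
    + -(Complex.I * Real.sqrt 2 * t) = 0 by push_cast; ring, Complex.exp_zero, one_mul] at hback
  have hgt : evolution t (evolution (-t) g) = g := by
    rw [← mul_apply_eq_comp, ← hU.map_add, add_neg_cancel, hU.map_zero, one_apply_eq_self]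
  rw [← hgt, ← map_sub, (LinearMap.norm_map_iff_inner_map_map (evolution t)).1
    (norm_apply_of_mem_unitary (hU.unitary t))]
  exact Submodule.starProjection_inner_eq_zero f _ hback

theorem evolution_conj_projQ (t : ℝ) (β : ℂ) :
    evolution t * projQ β * star (evolution t)
      = projQ (Complex.exp (-(Complex.I * Real.sqrt 2 * t)) * β) := by
  rw [evolution_mul_projQ, mul_assoc,
    Unitary.mul_star_self_of_mem (isSchrodingerGroup_evolution.unitary t), mul_one]

/-- The resolution of the identity `(1/π) ∫ Q_β d²β = 1`, weakly. It follows from that of the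
two-parameter family `ψ_{αβ}` by Fubini's theorem. -/
theorem integral_inner_projQ (f g : TwoModeSpace) :
    Integrable (fun β => ⟪f, projQ β g⟫_ℂ) ∧
      ∫ β, ⟪f, projQ β g⟫_ℂ = Real.pi * ⟪f, g⟫_ℂ := by
  have hpi : (Real.pi : ℂ) ≠ 0 := by exact_mod_cast Real.pi_ne_zero
  obtain ⟨h1, h2⟩ := isReproducing_twoModeState_prod.resolution f g
  rw [Submodule.starProjection_eq_self_iff.2 (closedSpan_twoModeState_prod ▸ Submodule.mem_top)]
    at h2
  rw [Measure.volume_eq_prod ℂ ℂ] at h1 h2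
  simp only [fun β => (isCoherentIntegral_projQ β f g).2]
  refine ⟨h1.integral_prod_right.const_mul _, ?_⟩
  rw [integral_const_mul, ← integral_prod_symm _ h1, h2]
  push_cast
  field_simp

end Projections

/-! ### The operator space -/

section OperatorSpan

theorem mem_closedOperatorSpan_iff {S : Set (TwoModeSpace →L[ℂ] TwoModeSpace)}
    {A : TwoModeSpace →L[ℂ] TwoModeSpace} :
    A ∈ closedOperatorSpan S ↔ ContinuousLinearMapWOT.ofCLM A ∈
      closure {B : TwoModeSpace →WOT[ℂ] TwoModeSpace |
        ContinuousLinearMapWOT.toCLM B ∈ Submodule.span ℂ S} := Iff.rfl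

theorem star_mem_closedOperatorSpan {S : Set (TwoModeSpace →L[ℂ] TwoModeSpace)}
    (hS : ∀ A ∈ S, star A ∈ S) {A : TwoModeSpace →L[ℂ] TwoModeSpace}
    (hA : A ∈ closedOperatorSpan S) : star A ∈ closedOperatorSpan S := by
  rw [mem_closedOperatorSpan_iff] at hA ⊢
  have hspan : ∀ B ∈ Submodule.span ℂ S, star B ∈ Submodule.span ℂ S := by
    intro B hB
    induction hB using Submodule.span_induction with
    | mem B hB => exact Submodule.subset_span (hS B hB)
    | zero => simp
    | add B C _ _ hB hC => rw [star_add]; exact add_mem hB hC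
    | smul k B _ hB => rw [star_smul]; exact Submodule.smul_mem _ _ hB
  exact map_mem_closure (f := fun B : TwoModeSpace →WOT[ℂ] TwoModeSpace => star B)
    continuous_star hA fun B hB => hspan _ hB

/-- An operator lies in the weak operator closure of a span if each finite set of matrix elements can
be matched exactly. -/
theorem mem_closedOperatorSpan_of_forall_finset {S : Set (TwoModeSpace →L[ℂ] TwoModeSpace)}
    {A : TwoModeSpace →L[ℂ] TwoModeSpace}
    (h : ∀ I : Finset (TwoModeSpace × StrongDual ℂ TwoModeSpace),
      ∃ B ∈ Submodule.span ℂ S, ∀ i ∈ I, i.2 (B i.1) = i.2 (A i.1)) :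
    A ∈ closedOperatorSpan S := by
  rw [mem_closedOperatorSpan_iff,
    ContinuousLinearMapWOT.isInducing_inducingFn.closure_eq_preimage_closure_image,
    Set.mem_preimage, mem_closure_iff]
  intro o ho hAo
  obtain ⟨I, u, hu, hsub⟩ := isOpen_pi_iff.1 ho _ hAo
  obtain ⟨B, hB, hBI⟩ := h I
  refine ⟨_, hsub fun i hi => ?_, Set.mem_image_of_mem _
    (show ContinuousLinearMapWOT.ofCLM B ∈ _ from hB)⟩
  have h2 := (hu i hi).2
  have h3 : ContinuousLinearMapWOT.inducingFn (RingHom.id ℂ) TwoModeSpace TwoModeSpace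
      (ContinuousLinearMapWOT.ofCLM B) i = ContinuousLinearMapWOT.inducingFn (RingHom.id ℂ)
        TwoModeSpace TwoModeSpace (ContinuousLinearMapWOT.ofCLM A) i := hBI i hi
  rwa [h3]

/-- The identity is in the closed span of the `Q_β`. Finitely many matrix elements form a vector in a
finite-dimensional space; a functional that kills the vectors of all `Q_β` kills their integral over
`β`, which is `π` times the vector of the identity. -/
theorem one_mem_closedOperatorSpan_range_projQ :
    (1 : TwoModeSpace →L[ℂ] TwoModeSpace) ∈ closedOperatorSpan (Set.range projQ) := by
  classical
  refine mem_closedOperatorSpan_of_forall_finset fun I => ?_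
  let Φ : (TwoModeSpace →L[ℂ] TwoModeSpace) →ₗ[ℂ] (I → ℂ) :=
    { toFun := fun B i => i.1.2 (B i.1.1)
      map_add' := fun B C => by ext i; simp
      map_smul' := fun k B => by ext i; simp }
  have hmem : Φ 1 ∈ (Submodule.span ℂ (Set.range projQ)).map Φ := by
    by_contra hnot
    obtain ⟨ℓ, hℓ1, hℓ⟩ := Submodule.exists_le_ker_of_notMem hnot
    refine hℓ1 ?_
    have hzero : ∀ β, ℓ (Φ (projQ β)) = 0 := fun β =>
      hℓ (Submodule.mem_map_of_mem (Submodule.subset_span ⟨β, rfl⟩))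
    have hsum : ∀ B, ℓ (Φ B) = ∑ i : I, ⟪(InnerProductSpace.toDual ℂ TwoModeSpace).symm i.1.2,
        B i.1.1⟫_ℂ * ℓ (fun j => if i = j then 1 else 0) := by
      intro B
      rw [LinearMap.pi_apply_eq_sum_univ]
      simp only [InnerProductSpace.toDual_symm_apply, smul_eq_mul]
      rfl
    have hint : ∫ β, ℓ (Φ (projQ β)) = Real.pi * ℓ (Φ 1) := by
      simp only [hsum]
      rw [integral_finsetSum _ fun i _ => (integral_inner_projQ _ _).1.mul_const _, Finset.mul_sum]
      refine Finset.sum_congr rfl fun i _ => ?_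
      rw [integral_mul_const, (integral_inner_projQ _ _).2, one_apply_eq_self, mul_assoc]
    simp only [hzero, integral_zero] at hint
    have hpi : (Real.pi : ℂ) ≠ 0 := by exact_mod_cast Real.pi_ne_zero
    exact (mul_eq_zero.1 hint.symm).resolve_left hpi
  obtain ⟨B, hB, hBΦ⟩ := hmem
  exact ⟨B, hB, fun i hi => congrFun hBΦ ⟨i, hi⟩⟩

/-- Every complex number is `r e^{i(φ - √2 t)}` for some `t` and `r ≥ 0`: the rotation by the evolution
reaches every angle, which is why the starting angle `φ` does not matter. -/
theorem exists_polar_rotated (φ : ℝ) (β : ℂ) :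
    ∃ t r : ℝ, 0 ≤ r ∧ β = r * Complex.exp (Complex.I * (φ - Real.sqrt 2 * t)) := by
  refine ⟨(φ - β.arg) / Real.sqrt 2, ‖β‖, norm_nonneg β, ?_⟩
  have hs0 : (Real.sqrt 2 : ℂ) ≠ 0 := by
    exact_mod_cast (Real.sqrt_pos.2 (by norm_num : (0 : ℝ) < 2)).ne'
  conv_lhs => rw [← Complex.norm_mul_exp_arg_mul_I β]
  congr 2
  push_cast
  field_simp
  ring

theorem setOf_projQ_eq_range (φ : ℝ) :
    {A | ∃ t r : ℝ, 0 ≤ r ∧ A = projQ (r * Complex.exp (Complex.I * (φ - Real.sqrt 2 * t)))}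
      = Set.range projQ := by
  ext A
  constructor
  · rintro ⟨t, r, -, rfl⟩
    exact ⟨_, rfl⟩
  · rintro ⟨β, rfl⟩
    obtain ⟨t, r, hr, hβ⟩ := exists_polar_rotated φ β
    exact ⟨t, r, hr, by rw [← hβ]⟩

theorem orbitGraph_eq (φ : ℝ) :
    orbitGraph φ = closedOperatorSpan {A | ∃ t r : ℝ, 0 ≤ r ∧
        A = projQ (r * Complex.exp (Complex.I * (φ - Real.sqrt 2 * t)))} := by
  have h : ∀ t r : ℝ, Complex.exp (-(Complex.I * Real.sqrt 2 * t))
      * (r * Complex.exp (Complex.I * φ))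
      = r * Complex.exp (Complex.I * (φ - Real.sqrt 2 * t)) := by
    intro t r
    rw [mul_left_comm, ← Complex.exp_add]
    congr 2
    ring
  simp only [orbitGraph, evolution_conj_projQ, h]

theorem orbitGraph_eq_range (φ : ℝ) : orbitGraph φ = closedOperatorSpan (Set.range projQ) := by
  rw [orbitGraph_eq, setOf_projQ_eq_range]

end OperatorSpan

end

theorem theorem1 :
    -- the group `e^{-itH}` exists, is unique, and is `evolution`
    (IsSchrodingerGroup evolution ∧ ∀ U, IsSchrodingerGroup U → U = evolution) ∧
    -- the integral defining `Q_β` exists weakly, and `Q_β` is an orthogonal projection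
    (∀ β : ℂ, IsCoherentIntegral β (projQ β) ∧ IsStarProjection (projQ β)) ∧
    -- the action of the group on the projections
    (∀ (t : ℝ) (β : ℂ), evolution t * projQ β * star (evolution t)
      = projQ (Complex.exp (-(Complex.I * Real.sqrt 2 * t)) * β)) ∧
    -- the operator space
    (∀ φ : ℝ,
      orbitGraph φ = closedOperatorSpan {A | ∃ t r : ℝ, 0 ≤ r ∧
        A = projQ (r * Complex.exp (Complex.I * (φ - Real.sqrt 2 * t)))} ∧
      IsNoncommutativeGraph (orbitGraph φ)) ∧
    -- it does not depend on the angle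
    (∀ φ φ' : ℝ, orbitGraph φ = orbitGraph φ') := by
  refine ⟨⟨isSchrodingerGroup_evolution, fun U hU => hU.eq_evolution⟩,
    fun β => ⟨isCoherentIntegral_projQ β, isStarProjection_projQ β⟩, evolution_conj_projQ,
    fun φ => ⟨orbitGraph_eq φ, ?_⟩, fun φ φ' => ?_⟩
  · rw [orbitGraph_eq_range]
    refine ⟨fun A hA => star_mem_closedOperatorSpan ?_ hA, one_mem_closedOperatorSpan_range_projQ⟩
    rintro _ ⟨β, rfl⟩
    exact ⟨β, (isStarProjection_projQ β).isSelfAdjoint.star_eq.symm⟩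
  · rw [orbitGraph_eq_range, orbitGraph_eq_range]
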